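/- Let $d\ge 1$ be an integer, let $\delta\in(0,2)$ and let $\lambda$ be a real number with $\delta\lambda\in(0,2]$. Let $$\mathcal D_{\lambda,\delta}(r)=1-\Bigl(\frac{r^\delta}{1+r^\delta}\Bigr)^{\lambda},\qquad r\ge 0,$$ be the Dagum function, and let $$\widehat{\mathcal D}_{\delta,\lambda}(z)=\frac{z^{1-d/2}}{(2\pi)^{d/2}}\int_0^\infty u^{d/2}J_{d/2-1}(uz)\,\mathcal D_{\lambda,\delta}(u)\,du,\qquad z>0,$$ be its isotropic spectral density in $\mathbb R^d$, where $J_\nu$ is the Bessel function of the first kind. Since the integral need not converge, it is understood as $\lim_{\varepsilon\to0^+}\int_0^\infty e^{-\varepsilon u^2}u^{d/2}J_{d/2-1}(uz)\,\mathcal D_{\lambda,\delta}(u)\,du$, which is the usual (proper or improper) integral whenever the latter converges. Then this limit exists for every $z>0$, and the spectral density has the following low-frequency behaviour. 1. If $\frac{d-2}{2}<\delta<d$, then $$\widehat{\mathcal D}_{\delta,\lambda}(z)\sim\frac{2^{-\delta}\lambda\,\Gamma(d/2-\delta/2)}{\pi^{d/2}\,\Gamma(\delta/2)}\,z^{\delta-d}\qquad\text{as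 } z\to0^+.$$ 2. If $d<\delta<2$, then $$\lim_{z\to0^+}\widehat{\mathcal D}_{\delta,\lambda}(z)=-\frac{1}{\delta\,\pi^{d/2}\,2^{d-1}\,\Gamma(d/2)}\cdot\frac{\Gamma(-d/\delta)\,\Gamma(d/\delta+\lambda)}{\Gamma(\lambda)}.$$ -/

import Mathlib

open Filter Topology MeasureTheory Set

noncomputable section

/-- The Bessel function of the first kind `J_ν(x)` of real order `ν`, for `x > 0`. At the poles of
the Gamma function the factor `1 / Γ(m + ν + 1)` is `0`, as usual. -/
def besselJ (ν x : ℝ) : ℝ :=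
  ∑' m : ℕ, (-1 : ℝ) ^ m / ((m.factorial : ℝ) * Real.Gamma ((m : ℝ) + ν + 1)) *
    (x / 2) ^ (2 * (m : ℝ) + ν)

/-- The Dagum function `1 - (r ^ δ / (1 + r ^ δ)) ^ lam`, for `r ≥ 0`. -/
def dagum (lam δ r : ℝ) : ℝ :=
  1 - (r ^ δ / (1 + r ^ δ)) ^ lam

/-- The integrand `u ^ (d/2) J_{d/2-1}(u z) φ(u)` of the `d`-dimensional Hankel transform. -/
def hankelIntegrand (d : ℕ) (φ : ℝ → ℝ) (z u : ℝ) : ℝ :=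
  u ^ ((d : ℝ) / 2) * besselJ ((d : ℝ) / 2 - 1) (u * z) * φ u

/-- The `d`-dimensional Hankel transform of `φ` at `z > 0` with the convergence factor
`exp (-ε u²)` in the integral. -/
def regularizedHankel (d : ℕ) (φ : ℝ → ℝ) (z ε : ℝ) : ℝ :=
  z ^ (1 - (d : ℝ) / 2) / (2 * Real.pi) ^ ((d : ℝ) / 2) *
    ∫ u in Ioi (0 : ℝ), Real.exp (-ε * u ^ 2) * hankelIntegrand d φ z u

/-- `L` is the value at `z > 0` of the isotropic spectral density in dimension `d` of the radial
function `φ`, that is, of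
`z ^ (1 - d/2) / (2π) ^ (d/2) * ∫₀^∞ u ^ (d/2) J_{d/2-1}(u z) φ(u) du`.
The integral over `(0, ∞)` is taken in the sense of Abel summation in the variable `u²`: this is
the Lebesgue integral if the integrand is integrable and the improper integral if that converges,
and it also covers slowly decaying `φ`, for which the integral has to be read as a generalized
one. -/
def HasIsotropicSpectralDensityAt (d : ℕ) (φ : ℝ → ℝ) (z L : ℝ) : Prop :=
  (∀ ε : ℝ, 0 < ε →
    IntegrableOn (fun u => Real.exp (-ε * u ^ 2) * hankelIntegrand d φ z u) (Ioi 0)) ∧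
  Tendsto (regularizedHankel d φ z) (𝓝[>] 0) (𝓝 L)

/-- The isotropic spectral density of `φ` in dimension `d`, as a function of `z > 0`. -/
def isotropicSpectralDensity (d : ℕ) (φ : ℝ → ℝ) (z : ℝ) : ℝ :=
  limUnder (𝓝[>] 0) (regularizedHankel d φ z)

end

/-! Put t = u², β = δ/2, so that the Dagum function becomes f(t) = 1 - (1 + t^(-β))^(-lam). This f
is a Stieltjes function. It continues analytically to the plane cut along the negative axis, and the
jump across the cut gives a density ρ(s) that is nonnegative: 1 + s^(-β) e^(-iπβ) has argument in
[-πβ, 0], and β lam ≤ 1. Cauchy's theorem gives f(t) = ∫ ρ(s)/(s + t) ds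
(`integrableOn_and_integral_dagumDensity_div`). Writing 1/(s + t) as a Laplace integral exhibits the
Dagum function as a mixture of Gaussians, ∫ e^(-τu²) m(τ) dτ, where m ≥ 0 is the Laplace transform
of ρ.

The Hankel transform of a Gaussian is a heat kernel, and the factor e^(-εu²) only shifts its time
from τ to τ + ε (`regularizedHankel_dagum`). Since m is integrable and the heat kernel at fixed z >
0 is bounded in time, ε → 0 yields the spectral density ∫ K_z(τ) m(τ) dτ.

Low frequencies are governed by m. The tail ρ(s) ~ lam sin(πβ)/π · s^(-β) at infinity gives m(τ) ~
lam τ^(β-1)/Γ(β) at 0. If δ < d, the scaling τ = z²σ and dominated convergence give the power law.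
If d < δ < 2, then d = 1 and τ^(-1/2) m(τ) is integrable, so z = 0 may be inserted; the limit is π⁻¹
times the integral of the Dagum function, a beta integral. -/

open Complex (exp) in
theorem one_add_exp_mem_slitPlane {w : ℂ} (h : |w.im| < Real.pi) :
    1 + exp w ∈ Complex.slitPlane := by
  rw [Complex.mem_slitPlane_iff]
  by_cases hw : w.im = 0
  · left
    simp only [Complex.add_re, Complex.one_re, Complex.exp_re, hw, Real.cos_zero, mul_one]
    positivity
  · right
    simp only [Complex.add_im, Complex.one_im, Complex.exp_im, zero_add]
    refine mul_ne_zero (Real.exp_pos _).ne' ?_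
    rw [abs_lt] at h
    exact fun h0 => hw ((Real.sin_eq_zero_iff_of_lt_of_lt h.1 h.2).1 h0)

/-! ### Analytic continuation to a strip, in the logarithmic variable -/

theorem norm_one_add_cpow_neg_le {lam : ℝ} (hlam : 0 < lam) {ζ : ℂ} (h : 1 / 2 ≤ ‖1 + ζ‖) :
    ‖(1 + ζ) ^ (-(lam : ℂ))‖ ≤ 2 ^ lam := by
  rw [← Complex.ofReal_neg, Complex.norm_cpow_real, Real.rpow_neg (norm_nonneg _),
    ← Real.inv_rpow (norm_nonneg _)]
  refine Real.rpow_le_rpow (by positivity) ?_ hlam.le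
  rw [inv_le_comm₀ (by linarith) two_pos]
  linarith

/-- The analytic continuation of `t ↦ 1 - (1 + t ^ (-β)) ^ (-lam)` in the logarithmic variable. -/
noncomputable def dagumLog (β lam : ℝ) (w : ℂ) : ℂ :=
  1 - (1 + Complex.exp (-(β : ℂ) * w)) ^ (-(lam : ℂ))

theorem neg_mul_im_lt {β : ℝ} (hβ : 0 < β) {w : ℂ} (h : |w.im| < Real.pi / β) :
    |(-(β : ℂ) * w).im| < Real.pi := by
  rw [lt_div_iff₀ hβ] at h
  simpa [abs_mul, abs_of_pos hβ, mul_comm] using h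

theorem differentiableAt_dagumLog {β : ℝ} (hβ : 0 < β) (lam : ℝ) {w : ℂ}
    (h : |w.im| < Real.pi / β) : DifferentiableAt ℂ (dagumLog β lam) w := by
  unfold dagumLog
  refine DifferentiableAt.const_sub ?_ _
  refine DifferentiableAt.cpow ?_ (differentiableAt_const _)
    (one_add_exp_mem_slitPlane (neg_mul_im_lt hβ h))
  fun_prop

theorem norm_exp_neg_mul (β : ℝ) (w : ℂ) :
    ‖Complex.exp (-(β : ℂ) * w)‖ = Real.exp (-β * w.re) := by
  rw [Complex.norm_exp]
  simp

/-- Cauchy's theorem for a divided difference quotient in the variable `exp w`. -/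
theorem integral_boundary_rect_exp_dslope_eq_zero {G : ℂ → ℂ} {a : ℝ} (ha : Real.pi < a)
    (ha' : a ≤ 2 * Real.pi)
    (hG : ∀ w : ℂ, |w.im| < a → DifferentiableAt ℂ G w) (x₀ R : ℝ) (hR : |x₀| < R) :
    let Q : ℂ → ℂ := fun w => (G w - G x₀) * Complex.exp w / (Complex.exp w - Complex.exp x₀)
    (∫ x : ℝ in -R..R, Q (x - Real.pi * Complex.I)) - (∫ x : ℝ in -R..R, Q (x + Real.pi * Complex.I))
      + Complex.I * (∫ y : ℝ in -Real.pi..Real.pi, Q (R + y * Complex.I))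
      - Complex.I * (∫ y : ℝ in -Real.pi..Real.pi, Q (-R + y * Complex.I)) = 0 := by
  intro Q
  have hpi := Real.pi_pos
  set S : Set ℂ := {w | |w.im| < a} with hS
  have hSo : IsOpen S := isOpen_lt (by fun_prop) continuous_const
  have hx₀ : (x₀ : ℂ) ∈ S := by simp [hS]; linarith
  -- The exponential has period 2πi, and a ≤ 2π leaves no translate of x₀ other than itself in the
  -- open strip.
  have hexp : ∀ w ∈ S, w ≠ x₀ → Complex.exp w - Complex.exp x₀ ≠ 0 := by
    intro w hw hne h0
    obtain ⟨n, hn⟩ := Complex.exp_eq_exp_iff_exists_int.1 (sub_eq_zero.1 h0)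
    have him : w.im = n * (2 * Real.pi) := by
      rw [hn]; simp
    have hn0 : n = 0 := by
      by_contra hn0
      have h1 : (1 : ℝ) ≤ |(n : ℝ)| := by
        exact_mod_cast Int.one_le_abs hn0
      have : |w.im| < a := hw
      rw [him, abs_mul, abs_of_pos (by positivity : 0 < 2 * Real.pi)] at this
      nlinarith
    apply hne
    rw [hn, hn0]; simp
  -- The singularity at x₀ is removable: Q is a quotient of two divided differences, and that of the
  -- exponential has no zero in the strip.
  have hdG : DifferentiableOn ℂ (dslope G x₀) S :=
    (Complex.differentiableOn_dslope (hSo.mem_nhds hx₀)).2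
      fun w hw => (hG w hw).differentiableWithinAt
  have hdE : DifferentiableOn ℂ (dslope Complex.exp x₀) S :=
    (Complex.differentiableOn_dslope (hSo.mem_nhds hx₀)).2
      Complex.differentiable_exp.differentiableOn
  have hdE0 : ∀ w ∈ S, dslope Complex.exp x₀ w ≠ 0 := by
    intro w hw
    by_cases h : w = x₀
    · rw [h, dslope_same, Complex.deriv_exp]
      exact Complex.exp_ne_zero _
    · rw [dslope_of_ne _ h, slope_def_field]
      exact div_ne_zero (hexp w hw h) (sub_ne_zero.2 h)
  have hF : DifferentiableOn ℂ
      (fun w => dslope G x₀ w * Complex.exp w / dslope Complex.exp x₀ w) S :=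
    (hdG.mul Complex.differentiable_exp.differentiableOn).div hdE hdE0
  have hQ : ∀ w : ℂ, w ∈ S → w ≠ x₀ →
      dslope G x₀ w * Complex.exp w / dslope Complex.exp x₀ w = Q w := by
    intro w hw hne
    have h1 := hexp w hw hne
    have h2 : w - x₀ ≠ 0 := sub_ne_zero.2 hne
    simp only [Q]
    rw [dslope_of_ne _ hne, dslope_of_ne _ hne, slope_def_field, slope_def_field]
    field_simp
  have hR0 : 0 < R := (abs_nonneg _).trans_lt hR
  have key := Complex.integral_boundary_rect_eq_zero_of_differentiableOn
    (fun w => dslope G x₀ w * Complex.exp w / dslope Complex.exp x₀ w)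
    (-R - Real.pi * Complex.I) (R + Real.pi * Complex.I) (hF.mono (by
      intro w hw
      rw [Complex.mem_reProdIm] at hw
      have h2 := hw.2
      simp only [Complex.sub_im, Complex.neg_im, Complex.ofReal_im, Complex.mul_im,
        Complex.ofReal_re, Complex.I_im, Complex.I_re, Complex.add_im] at h2
      rw [Set.uIcc_of_le (by linarith)] at h2
      have : |w.im| ≤ Real.pi := abs_le.2 ⟨by linarith [h2.1], by linarith [h2.2]⟩
      exact this.trans_lt ha))
  simp only [Complex.sub_im, Complex.neg_im, Complex.ofReal_im, Complex.mul_im,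
        Complex.ofReal_re, Complex.I_im, Complex.I_re, Complex.add_im, Complex.sub_re,
        Complex.neg_re, Complex.mul_re, Complex.add_re, mul_zero, mul_one, add_zero,
        zero_add, neg_zero, sub_zero, zero_sub, smul_eq_mul] at key
  rw [← key]
  have him : ∀ y : ℝ, y ∈ Icc (-Real.pi) Real.pi → ∀ x : ℝ, (x + y * Complex.I : ℂ) ∈ S := by
    intro y hy x
    simp only [hS, Set.mem_ofPred_eq, Complex.add_im, Complex.ofReal_im, Complex.mul_im,
      Complex.ofReal_re, Complex.I_im, Complex.I_re, mul_zero, mul_one, zero_add, add_zero]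
    exact (abs_le.2 hy).trans_lt ha
  congr 1
  · congr 1
    · congr 1
      · refine intervalIntegral.integral_congr fun x _ => ?_
        have h1 := him (-Real.pi) ⟨le_rfl, by linarith⟩ x
        have h3 : (x + (-Real.pi : ℝ) * Complex.I : ℂ) ≠ x₀ := by
          intro h
          have := congrArg Complex.im h
          simp at this
        have := hQ _ h1 h3
        push_cast at this ⊢
        rw [this]
        congr 1
        ring
      · refine intervalIntegral.integral_congr fun x _ => ?_
        have h1 := him Real.pi ⟨by linarith, le_rfl⟩ x
        have h3 : (x + Real.pi * Complex.I : ℂ) ≠ x₀ := by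
          intro h
          have := congrArg Complex.im h
          simp at this
        exact (hQ _ h1 h3).symm
    · congr 1
      refine intervalIntegral.integral_congr fun y hy => ?_
      rw [Set.uIcc_of_le (by linarith)] at hy
      refine (hQ _ (him y hy R) ?_).symm
      intro h
      have := congrArg Complex.re h
      simp at this
      rw [← this, abs_of_pos hR0] at hR
      exact lt_irrefl _ hR
  · congr 1
    refine intervalIntegral.integral_congr fun y hy => ?_
    rw [Set.uIcc_of_le (by linarith)] at hy
    have h1 := him y hy (-R)
    have h3 : ((-R : ℝ) + y * Complex.I : ℂ) ≠ x₀ := by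
      intro h
      have := congrArg Complex.re h
      simp at this
      rw [← this, abs_neg, abs_of_pos hR0] at hR
      exact lt_irrefl _ hR
    have := hQ _ h1 h3
    push_cast at this ⊢
    exact this.symm

/-- The hypothesis keeps exp(-βw) away from the unit circle, hence from the branch point -1. It
holds on both vertical sides of a sufficiently wide rectangle. -/
theorem norm_dagumLog_le {β lam : ℝ} (hlam : 0 < lam) {w : ℂ}
    (h : Real.exp (-β * w.re) ≤ 1 / 2 ∨ 2 ≤ Real.exp (-β * w.re)) :
    ‖dagumLog β lam w‖ ≤ 1 + 2 ^ lam := by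
  unfold dagumLog
  refine (norm_sub_le _ _).trans ?_
  rw [norm_one]
  gcongr
  apply norm_one_add_cpow_neg_le hlam
  rw [← norm_exp_neg_mul] at h
  rcases h with h | h
  · have := norm_sub_le (1 + Complex.exp (-(β : ℂ) * w)) (Complex.exp (-(β : ℂ) * w))
    rw [add_sub_cancel_right, norm_one] at this
    linarith
  · have := norm_sub_le (1 + Complex.exp (-(β : ℂ) * w)) 1
    rw [add_sub_cancel_left, norm_one] at this
    linarith

/-- Reflection symmetry reduces the difference of the two horizontal sides of the contour to an
imaginary part. -/
theorem dagumLog_conj {β : ℝ} (hβ : 0 < β) (lam : ℝ) {w : ℂ} (h : |w.im| < Real.pi / β) :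
    dagumLog β lam (starRingEnd ℂ w) = starRingEnd ℂ (dagumLog β lam w) := by
  unfold dagumLog
  have h1 := one_add_exp_mem_slitPlane (neg_mul_im_lt hβ h)
  have h2 := Complex.conj_cpow (1 + Complex.exp (-(β : ℂ) * w)) (-(lam : ℂ))
    (Complex.slitPlane_arg_ne_pi h1)
  simp only [map_neg, Complex.conj_ofReal, map_add, map_one, ← Complex.exp_conj, map_mul] at h2
  rw [map_sub, map_one, ← h2]

theorem dagumLog_ofReal (β lam x : ℝ) :
    dagumLog β lam x = ((1 - (1 + Real.exp (-β * x)) ^ (-lam) : ℝ) : ℂ) := by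
  unfold dagumLog
  push_cast
  rw [Complex.ofReal_cpow (by positivity)]
  push_cast
  rfl

theorem tendsto_dagumLog_right {β lam : ℝ} (hβ : 0 < β) (y : ℝ) :
    Tendsto (fun R : ℝ => dagumLog β lam (R + y * Complex.I)) atTop (𝓝 0) := by
  have h0 : Tendsto (fun R : ℝ => Complex.exp (-(β : ℂ) * (R + y * Complex.I))) atTop (𝓝 0) := by
    rw [tendsto_zero_iff_norm_tendsto_zero]
    simp only [norm_exp_neg_mul]
    simp only [Complex.add_re, Complex.ofReal_re, Complex.mul_re, Complex.I_re, mul_zero,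
      Complex.ofReal_im, Complex.I_im, mul_one, sub_self, add_zero]
    exact Real.tendsto_exp_atBot.comp (tendsto_id.const_mul_atTop_of_neg (by linarith))
  have h1 : ContinuousAt (fun ζ : ℂ => 1 - (1 + ζ) ^ (-(lam : ℂ))) 0 := by
    refine continuousAt_const.sub (ContinuousAt.cpow (by fun_prop) continuousAt_const ?_)
    simp
  have := h1.tendsto.comp h0
  simpa [dagumLog, Function.comp_def] using this

/-! ### The jump density and its positivity -/

/-- The density `s ↦ π⁻¹ Im ((1 + s ^ (-β) e ^ (-iπβ)) ^ (-lam))`. -/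
noncomputable def dagumDensity (β lam s : ℝ) : ℝ :=
  ((1 + ((s ^ (-β) : ℝ) : ℂ) * Complex.exp (-(Real.pi * β : ℝ) * Complex.I)) ^
    (-(lam : ℂ))).im / Real.pi

theorem im_dagumLog (β lam x : ℝ) :
    (dagumLog β lam (x + Real.pi * Complex.I)).im = -Real.pi * dagumDensity β lam (Real.exp x) := by
  unfold dagumLog dagumDensity
  rw [← Real.exp_mul, Complex.ofReal_exp, ← Complex.exp_add, Complex.sub_im, Complex.one_im]
  have : -(β : ℂ) * (x + Real.pi * Complex.I) =
      ((x * -β : ℝ) : ℂ) + -(Real.pi * β : ℝ) * Complex.I := by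
    push_cast; ring
  rw [this]
  field_simp
  ring

/-- The function `1 + r e ^ (-iθ)` has argument in `[-θ, 0]`. -/
theorem arg_one_add_mem {θ r : ℝ} (hθ : θ ∈ Ioo 0 Real.pi) (hr : 0 < r) :
    Complex.arg (1 + (r : ℂ) * Complex.exp (-(θ : ℂ) * Complex.I)) ∈ Icc (-θ) 0 := by
  set z := 1 + (r : ℂ) * Complex.exp (-(θ : ℂ) * Complex.I) with hz
  have hsin := Real.sin_pos_of_mem_Ioo hθ
  have e1 : Complex.exp (-(θ : ℂ) * Complex.I) = Real.cos θ - Real.sin θ * Complex.I := by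
    rw [Complex.exp_mul_I, Complex.cos_neg, Complex.sin_neg]
    push_cast; ring
  have him : z.im = -(r * Real.sin θ) := by
    rw [hz, e1]; simp
    simp [Complex.sin_ofReal_re]
  have hre : z.re = 1 + r * Real.cos θ := by
    rw [hz, e1]; simp
    simp [Complex.cos_ofReal_re]
  have himneg : z.im < 0 := by rw [him]; nlinarith [mul_pos hr hsin]
  have harg : Complex.arg z < 0 := Complex.arg_neg_iff.2 himneg
  refine ⟨?_, harg.le⟩
  -- Multiplication by e^(iθ) turns z into e^(iθ) + r, so ‖z‖ sin(θ + arg z) = sin θ > 0; an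
  -- argument below -θ would make the left side negative.
  by_contra! hlt
  have hz0 : 0 < ‖z‖ := norm_pos_iff.2 (fun h => by rw [h] at himneg; simp at himneg)
  have h1 : Real.sin (θ + Complex.arg z) < 0 :=
    Real.sin_neg_of_neg_of_neg_pi_lt (by linarith) (by linarith [Complex.neg_pi_lt_arg z, hθ.1])
  rw [Real.sin_add] at h1
  have h2 := Complex.norm_mul_cos_arg z
  have h3 := Complex.norm_mul_sin_arg z
  have h4 : ‖z‖ * (Real.sin θ * Real.cos z.arg + Real.cos θ * Real.sin z.arg) < 0 :=
    mul_neg_of_pos_of_neg hz0 h1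
  have : ‖z‖ * (Real.sin θ * Real.cos z.arg + Real.cos θ * Real.sin z.arg) = Real.sin θ := by
    calc _ = Real.sin θ * (‖z‖ * Real.cos z.arg) + Real.cos θ * (‖z‖ * Real.sin z.arg) := by ring
      _ = _ := by rw [h2, h3, him, hre]; ring
  linarith

theorem dagumDensity_nonneg {β lam s : ℝ} (hβ : β ∈ Ioo (0 : ℝ) 1) (hlam : 0 < lam)
    (hβlam : β * lam ≤ 1) (hs : 0 < s) : 0 ≤ dagumDensity β lam s := by
  have hpi := Real.pi_pos
  unfold dagumDensity
  refine div_nonneg ?_ hpi.le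
  have harg := arg_one_add_mem (θ := Real.pi * β) (r := s ^ (-β))
    ⟨by nlinarith [hβ.1], by nlinarith [hβ.2]⟩ (by positivity)
  set z := 1 + ((s ^ (-β) : ℝ) : ℂ) * Complex.exp (-(Real.pi * β : ℝ) * Complex.I)
  rw [← Complex.ofReal_neg, Complex.cpow_ofReal_im]
  -- The power -lam carries the argument from [-πβ, 0] into [0, πβ lam], which lies in [0, π], where
  -- the sine is nonnegative.
  refine mul_nonneg (by positivity) (Real.sin_nonneg_of_nonneg_of_le_pi ?_ ?_)
  · nlinarith [harg.2]
  · nlinarith [harg.1, mul_le_mul_of_nonneg_left hβlam hpi.le]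

/-! ### Contour integration and the Stieltjes representation -/

theorem integral_comp_exp_mul_exp (h : ℝ → ℝ) :
    (∫ x, h (Real.exp x) * Real.exp x) = ∫ s in Ioi 0, h s := by
  have := integral_image_eq_integral_abs_deriv_smul (s := univ) (f := Real.exp)
    (f' := Real.exp) MeasurableSet.univ
    (fun x _ => (Real.hasDerivAt_exp x).hasDerivWithinAt) Real.exp_injective.injOn h
  rw [image_univ, Real.range_exp] at this
  simp only [Real.abs_exp, smul_eq_mul, Measure.restrict_univ] at this
  rw [this]
  simp only [mul_comm]

theorem integrable_comp_exp_mul_exp (h : ℝ → ℝ) :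
    Integrable (fun x => h (Real.exp x) * Real.exp x) ↔ IntegrableOn h (Ioi 0) := by
  have := integrableOn_image_iff_integrableOn_abs_deriv_smul (s := univ) (f := Real.exp)
    (f' := Real.exp) MeasurableSet.univ
    (fun x _ => (Real.hasDerivAt_exp x).hasDerivWithinAt) Real.exp_injective.injOn h
  rw [image_univ, Real.range_exp] at this
  simp only [Real.abs_exp, smul_eq_mul, integrableOn_univ] at this
  rw [this]
  simp only [mul_comm]

/-- Far to the right the continuation tends to 0 and the kernel exp w / (exp w - exp x₀) to 1, so
only the subtracted constant c survives. With c the value at x₀, this side produces the represented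
function. -/
theorem tendsto_integral_dagumLog_right {β lam : ℝ} (hβ : β ∈ Ioo (0 : ℝ) 1) (hlam : 0 < lam)
    (x₀ : ℝ) (c : ℂ) :
    Tendsto (fun R : ℝ => ∫ y : ℝ in -Real.pi..Real.pi,
      (dagumLog β lam (R + y * Complex.I) - c) * Complex.exp (R + y * Complex.I) /
        (Complex.exp (R + y * Complex.I) - Complex.exp x₀)) atTop
      (𝓝 (∫ _y : ℝ in -Real.pi..Real.pi, -c)) := by
  have hpi := Real.pi_pos
  have hdiff : ∀ R y : ℝ, y ∈ Icc (-Real.pi) Real.pi →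
      DifferentiableAt ℂ (dagumLog β lam) (R + y * Complex.I) := by
    intro R y hy
    apply differentiableAt_dagumLog hβ.1
    have : (R + y * Complex.I : ℂ).im = y := by simp
    rw [this, lt_div_iff₀ hβ.1]
    have := abs_le.2 hy
    nlinarith [hβ.1, hβ.2, abs_nonneg y]
  have hexp0 : ∀ᶠ R : ℝ in atTop, Real.exp x₀ * Real.exp (-R) ≤ 1 / 2 := by
    have : Tendsto (fun R : ℝ => Real.exp x₀ * Real.exp (-R)) atTop (𝓝 (Real.exp x₀ * 0)) :=
      (Real.tendsto_exp_neg_atTop_nhds_zero).const_mul _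
    rw [mul_zero] at this
    exact this.eventually_le_const (by norm_num)
  have hre : ∀ R y : ℝ, (R + y * Complex.I : ℂ).re = R := by simp
  have hsmall : ∀ᶠ R : ℝ in atTop, Real.exp (-β * R) ≤ 1 / 2 := by
    have : Tendsto (fun R : ℝ => Real.exp (-β * R)) atTop (𝓝 0) :=
      Real.tendsto_exp_atBot.comp (tendsto_id.const_mul_atTop_of_neg (by linarith [hβ.1]))
    exact this.eventually_le_const (by norm_num)
  have hform : ∀ R y : ℝ, ∀ g : ℂ, g * Complex.exp (R + y * Complex.I) /
        (Complex.exp (R + y * Complex.I) - Complex.exp x₀) =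
        g / (1 - Complex.exp x₀ * Complex.exp (-(R + y * Complex.I))) := by
    intro R y g
    have h1 : Complex.exp (R + y * Complex.I) - Complex.exp x₀ =
        Complex.exp (R + y * Complex.I) *
          (1 - Complex.exp x₀ * Complex.exp (-(R + y * Complex.I))) := by
      rw [Complex.exp_neg]
      have := Complex.exp_ne_zero (R + y * Complex.I)
      field_simp
    rw [h1, mul_comm g, mul_div_mul_left _ _ (Complex.exp_ne_zero _)]
  have hnorm : ∀ R y : ℝ, ‖Complex.exp x₀ * Complex.exp (-(R + y * Complex.I))‖ =
      Real.exp x₀ * Real.exp (-R) := by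
    intro R y
    rw [norm_mul, Complex.norm_exp, Complex.norm_exp]
    simp
  have hden : ∀ R y : ℝ, Real.exp x₀ * Real.exp (-R) ≤ 1 / 2 →
      1 / 2 ≤ ‖1 - Complex.exp x₀ * Complex.exp (-(R + y * Complex.I))‖ := by
    intro R y h
    have := norm_sub_norm_le 1 (Complex.exp x₀ * Complex.exp (-(R + y * Complex.I)))
    rw [hnorm, norm_one] at this
    linarith
  simp only [hform]
  refine intervalIntegral.tendsto_integral_filter_of_dominated_convergence
    (fun _ => (1 + 2 ^ lam + ‖c‖) * 2) ?_ ?_ intervalIntegrable_const ?_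
  · filter_upwards [hexp0] with R hR
    refine ContinuousOn.aestronglyMeasurable ?_ measurableSet_uIoc
    refine ContinuousOn.div ?_ (by fun_prop) ?_
    · refine ContinuousOn.sub ?_ continuousOn_const
      intro y hy
      rw [uIoc_of_le (by linarith)] at hy
      exact ((hdiff R y (Ioc_subset_Icc_self hy)).continuousAt.comp
        (f := fun y : ℝ => (R + y * Complex.I : ℂ)) (by fun_prop)).continuousWithinAt
    · intro y _ h0
      have := hden R y hR
      rw [h0, norm_zero] at this
      norm_num at this
  · filter_upwards [hexp0, hsmall] with R hR hR2
    refine ae_of_all _ fun y _ => ?_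
    rw [norm_div, div_eq_mul_inv]
    refine mul_le_mul ?_ ?_ (by positivity) (by positivity)
    · refine (norm_sub_le _ _).trans ?_
      gcongr
      exact norm_dagumLog_le hlam (Or.inl (by rwa [hre]))
    · rw [inv_le_comm₀ (by linarith [hden R y hR]) two_pos]
      simpa using hden R y hR
  · refine ae_of_all _ fun y _ => ?_
    have h1 : Tendsto (fun R : ℝ => Complex.exp x₀ * Complex.exp (-(R + y * Complex.I))) atTop
        (𝓝 0) := by
      rw [tendsto_zero_iff_norm_tendsto_zero]
      simp only [hnorm]
      simpa using (Real.tendsto_exp_neg_atTop_nhds_zero).const_mul (Real.exp x₀)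
    have := ((tendsto_dagumLog_right (lam := lam) hβ.1 y).sub_const c).div
      (h1.const_sub 1) (by norm_num)
    simpa [Pi.div_def] using this

/-- Far to the left the continuation stays bounded while the kernel is of size exp(-R). -/
theorem tendsto_integral_dagumLog_left {β lam : ℝ} (hβ : β ∈ Ioo (0 : ℝ) 1) (hlam : 0 < lam)
    (x₀ : ℝ) (c : ℂ) :
    Tendsto (fun R : ℝ => ∫ y : ℝ in -Real.pi..Real.pi,
      (dagumLog β lam (-R + y * Complex.I) - c) * Complex.exp (-R + y * Complex.I) /
        (Complex.exp (-R + y * Complex.I) - Complex.exp x₀)) atTop (𝓝 0) := by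
  have hpi := Real.pi_pos
  have he : Tendsto (fun R : ℝ => Real.exp (-R)) atTop (𝓝 0) :=
    Real.tendsto_exp_neg_atTop_nhds_zero
  have hexp0 : ∀ᶠ R : ℝ in atTop, Real.exp (-R) ≤ Real.exp x₀ / 2 :=
    he.eventually_le_const (by positivity)
  have hlarge : ∀ᶠ R : ℝ in atTop, 2 ≤ Real.exp (-β * -R) := by
    have : Tendsto (fun R : ℝ => Real.exp (-β * -R)) atTop atTop := by
      simp only [neg_mul_neg]
      exact Real.tendsto_exp_atTop.comp (tendsto_id.const_mul_atTop hβ.1)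
    exact this.eventually_ge_atTop 2
  have hlim : Tendsto (fun R : ℝ => (1 + 2 ^ lam + ‖c‖) * Real.exp (-R) / (Real.exp x₀ / 2) *
      |Real.pi - -Real.pi|) atTop (𝓝 0) := by
    have := ((he.const_mul (1 + 2 ^ lam + ‖c‖)).div_const (Real.exp x₀ / 2)).mul_const
      |Real.pi - -Real.pi|
    simpa using this
  refine squeeze_zero_norm' ?_ hlim
  filter_upwards [hexp0, hlarge] with R hR hR2
  refine intervalIntegral.norm_integral_le_of_norm_le_const fun y _ => ?_
  have hn : ‖Complex.exp (-R + y * Complex.I)‖ = Real.exp (-R) := by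
    rw [Complex.norm_exp]; simp
  rw [norm_div, norm_mul, hn]
  refine div_le_div₀ (by positivity) ?_ (by positivity) ?_
  · gcongr
    refine (norm_sub_le _ _).trans ?_
    gcongr
    refine norm_dagumLog_le hlam (Or.inr ?_)
    simpa using hR2
  · have := norm_sub_norm_le (Complex.exp x₀) (Complex.exp (-R + y * Complex.I))
    rw [hn, norm_sub_rev, Complex.norm_exp_ofReal] at this
    linarith

theorem continuous_dagumLog_line {β : ℝ} (hβ : β ∈ Ioo (0 : ℝ) 1) (lam : ℝ) {b : ℂ}
    (hb : |b.im| ≤ Real.pi) : Continuous fun x : ℝ => dagumLog β lam (x + b) := by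
  refine continuous_iff_continuousAt.2 fun x => ?_
  have hd : DifferentiableAt ℂ (dagumLog β lam) (x + b) := by
    apply differentiableAt_dagumLog hβ.1
    rw [Complex.add_im, Complex.ofReal_im, zero_add, lt_div_iff₀ hβ.1]
    nlinarith [hβ.1, hβ.2, abs_nonneg b.im, Real.pi_pos]
  exact hd.continuousAt.comp (f := fun x : ℝ => (x + b : ℂ)) (by fun_prop)

theorem continuous_dagumDensity_exp {β : ℝ} (hβ : β ∈ Ioo (0 : ℝ) 1) (lam : ℝ) :
    Continuous fun x : ℝ => dagumDensity β lam (Real.exp x) := by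
  have h : (fun x : ℝ => dagumDensity β lam (Real.exp x)) =
      fun x : ℝ => (dagumLog β lam (x + Real.pi * Complex.I)).im / -Real.pi := by
    funext x
    rw [im_dagumLog]
    field_simp
  rw [h]
  refine (Complex.continuous_im.comp (continuous_dagumLog_line hβ lam ?_)).div_const _
  simp [abs_of_pos Real.pi_pos]

theorem tendsto_intervalIntegral_dagumDensity {β lam : ℝ} (hβ : β ∈ Ioo (0 : ℝ) 1)
    (hlam : 0 < lam) (x₀ : ℝ) :
    Tendsto (fun R : ℝ => ∫ x in -R..R, dagumDensity β lam (Real.exp x) * (Real.exp x /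
      (Real.exp x + Real.exp x₀))) atTop (𝓝 (1 - (1 + Real.exp (-β * x₀)) ^ (-lam))) := by
  have hpi := Real.pi_pos
  set c : ℂ := dagumLog β lam x₀ with hc
  -- Since β < 1, the strip of holomorphy |Im w| < π/β contains the closed strip |Im w| ≤ π.
  have ha : Real.pi < min (Real.pi / β) (2 * Real.pi) := by
    refine lt_min ?_ (by linarith)
    rw [lt_div_iff₀ hβ.1]
    nlinarith [hβ.2]
  have hstep : ∀ᶠ R : ℝ in atTop, ((∫ x in -R..R, dagumDensity β lam (Real.exp x) * (Real.exp x /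
      (Real.exp x + Real.exp x₀)) : ℝ) : ℂ) =
      -((∫ y : ℝ in -Real.pi..Real.pi,
      (dagumLog β lam (R + y * Complex.I) - c) * Complex.exp (R + y * Complex.I) /
        (Complex.exp (R + y * Complex.I) - Complex.exp x₀)) - (∫ y : ℝ in -Real.pi..Real.pi,
      (dagumLog β lam (-R + y * Complex.I) - c) * Complex.exp (-R + y * Complex.I) /
        (Complex.exp (-R + y * Complex.I) - Complex.exp x₀))) / (2 * Real.pi) := by
    filter_upwards [eventually_gt_atTop |x₀|] with R hR
    have key := integral_boundary_rect_exp_dslope_eq_zero ha (min_le_right _ _)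
      (fun w hw => differentiableAt_dagumLog hβ.1 lam (hw.trans_le (min_le_left _ _))) x₀ R hR
    simp only at key
    rw [← hc] at key
    -- On both horizontal sides exp w = -exp x, so the kernel takes the same real value; the
    -- constant c then cancels in their difference, leaving only the jump.
    have hk : ∀ x : ℝ, (-Complex.exp x / (-Complex.exp x - Complex.exp x₀) : ℂ) =
        ((Real.exp x / (Real.exp x + Real.exp x₀) : ℝ) : ℂ) := by
      intro x
      push_cast
      rw [← neg_add', neg_div_neg_eq]
    have hkc : Continuous fun x : ℝ => Real.exp x / (Real.exp x + Real.exp x₀) := by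
      refine Continuous.div (by fun_prop) (by fun_prop) fun x => by positivity
    have e1 : ∀ x : ℝ, Complex.exp (x - Real.pi * Complex.I) = -Complex.exp x := by
      intro x
      rw [Complex.exp_sub, Complex.exp_pi_mul_I]; ring
    have e2 : ∀ x : ℝ, Complex.exp (x + Real.pi * Complex.I) = -Complex.exp x := by
      intro x
      rw [Complex.exp_add, Complex.exp_pi_mul_I]; ring
    simp only [e1, e2, mul_div_assoc, hk] at key
    have hcont : ∀ b : ℂ, |b.im| ≤ Real.pi → Continuous fun x : ℝ =>
        (dagumLog β lam (x + b) - c) * ((Real.exp x / (Real.exp x + Real.exp x₀) : ℝ) : ℂ) :=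
      fun b hb => ((continuous_dagumLog_line hβ lam hb).sub continuous_const).mul
        (Complex.continuous_ofReal.comp hkc)
    have hc1 := hcont (-(Real.pi * Complex.I)) (by simp [abs_of_pos hpi])
    have hc2 := hcont (Real.pi * Complex.I) (by simp [abs_of_pos hpi])
    simp only [← sub_eq_add_neg] at hc1
    rw [← intervalIntegral.integral_sub (hc1.intervalIntegrable _ _)
      (hc2.intervalIntegrable _ _)] at key
    have hdiff : ∀ x : ℝ, (dagumLog β lam (x - Real.pi * Complex.I) - c) *
        ((Real.exp x / (Real.exp x + Real.exp x₀) : ℝ) : ℂ) -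
        (dagumLog β lam (x + Real.pi * Complex.I) - c) *
        ((Real.exp x / (Real.exp x + Real.exp x₀) : ℝ) : ℂ) =
        (2 * Real.pi * Complex.I) * ((dagumDensity β lam (Real.exp x) * (Real.exp x /
          (Real.exp x + Real.exp x₀)) : ℝ) : ℂ) := by
      intro x
      have h1 : (x - Real.pi * Complex.I : ℂ) = starRingEnd ℂ (x + Real.pi * Complex.I) := by
        simp [sub_eq_add_neg]
      rw [h1, dagumLog_conj hβ.1]
      · have h2 := Complex.sub_conj (dagumLog β lam (x + Real.pi * Complex.I))
        rw [im_dagumLog] at h2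
        rw [← sub_mul, sub_sub_sub_cancel_right, ← neg_sub (dagumLog β lam _), h2]
        push_cast
        ring
      · simp only [Complex.add_im, Complex.ofReal_im, Complex.mul_im, Complex.ofReal_re,
          Complex.I_im, Complex.I_re, mul_zero, mul_one, zero_add, add_zero, abs_of_pos hpi]
        exact ha.trans_le (min_le_left _ _)
    simp only [hdiff] at key
    rw [intervalIntegral.integral_const_mul, intervalIntegral.integral_ofReal] at key
    have hpi0 : (Real.pi : ℂ) ≠ 0 := by exact_mod_cast hpi.ne'
    simp only [← mul_div_assoc] at key ⊢
    rw [eq_div_iff (by simp [hpi0])]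
    refine mul_left_cancel₀ Complex.I_ne_zero ?_
    linear_combination key
  have hl := (((tendsto_integral_dagumLog_right hβ hlam x₀ c).sub
    (tendsto_integral_dagumLog_left hβ hlam x₀ c)).neg).div_const (2 * Real.pi : ℂ)
  have hl2 := hl.congr' (hstep.mono fun R h => h.symm)
  have := (Complex.continuous_re.tendsto _).comp hl2
  simp only [Function.comp_def, Complex.ofReal_re] at this
  convert this using 2
  have hpi0 : (Real.pi : ℂ) ≠ 0 := by exact_mod_cast hpi.ne'
  have : -((∫ _y : ℝ in -Real.pi..Real.pi, -c) - 0) / (2 * Real.pi) = c := by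
    rw [intervalIntegral.integral_const, Complex.real_smul]
    push_cast
    field_simp
    ring
  rw [this, hc, dagumLog_ofReal, Complex.ofReal_re]

/-- Stieltjes representation of `t ↦ 1 - (1 + t ^ (-β)) ^ (-lam)`. -/
theorem integrableOn_and_integral_dagumDensity_div {β lam : ℝ} (hβ : β ∈ Ioo (0 : ℝ) 1)
    (hlam : 0 < lam) (hβlam : β * lam ≤ 1) {t : ℝ} (ht : 0 < t) :
    IntegrableOn (fun s => dagumDensity β lam s / (s + t)) (Ioi 0) ∧
      ∫ s in Ioi 0, dagumDensity β lam s / (s + t) = 1 - (1 + t ^ (-β)) ^ (-lam) := by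
  have hlim := tendsto_intervalIntegral_dagumDensity hβ hlam (Real.log t)
  rw [Real.exp_log ht] at hlim
  have hE : (fun x : ℝ => dagumDensity β lam (Real.exp x) * (Real.exp x / (Real.exp x + t))) =
      fun x => (fun s => dagumDensity β lam s / (s + t)) (Real.exp x) * Real.exp x := by
    funext x
    simp only
    ring
  have hcont : Continuous fun x : ℝ =>
      dagumDensity β lam (Real.exp x) * (Real.exp x / (Real.exp x + t)) :=
    (continuous_dagumDensity_exp hβ lam).mul
      (Continuous.div (by fun_prop) (by fun_prop) fun x => by positivity)
  -- The integrand is nonnegative, so convergence of the integrals over [-R, R] already gives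
  -- absolute integrability.
  have hint : Integrable fun x : ℝ =>
      dagumDensity β lam (Real.exp x) * (Real.exp x / (Real.exp x + t)) := by
    refine integrable_of_intervalIntegral_norm_tendsto (l := atTop) (a := fun R : ℝ => -R)
      (b := fun R => R) _ (fun R => hcont.integrableOn_Ioc) tendsto_neg_atTop_atBot tendsto_id
      (hlim.congr fun R => ?_)
    refine intervalIntegral.integral_congr fun x _ => ?_
    exact (Real.norm_of_nonneg (mul_nonneg
      (dagumDensity_nonneg hβ hlam hβlam (Real.exp_pos x)) (by positivity))).symm
  have hval := tendsto_nhds_unique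
    (intervalIntegral_tendsto_integral hint tendsto_neg_atTop_atBot tendsto_id) hlim
  rw [hE] at hint
  simp only [hE] at hval
  refine ⟨(integrable_comp_exp_mul_exp _).1 hint, ?_⟩
  rw [← integral_comp_exp_mul_exp, hval, Real.rpow_def_of_pos ht]
  ring_nf

/-! ### Decay of the jump density at infinity -/

theorem measurable_dagumDensity (β lam : ℝ) : Measurable (dagumDensity β lam) := by
  unfold dagumDensity
  refine (Complex.measurable_im.comp ?_).div_const _
  refine Measurable.pow_const ?_ _
  fun_prop

/-- After rotation by e^(iθ) the imaginary part is exactly sin θ, whatever y is. -/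
theorem sin_le_norm_one_add {θ : ℝ} (y : ℝ) :
    Real.sin θ ≤ ‖1 + (y : ℂ) * Complex.exp (-(θ : ℝ) * Complex.I)‖ := by
  have h1 : ‖1 + (y : ℂ) * Complex.exp (-(θ : ℝ) * Complex.I)‖ =
      ‖Complex.exp (θ * Complex.I) + y‖ := by
    have : Complex.exp (θ * Complex.I) + y = Complex.exp (θ * Complex.I) *
        (1 + (y : ℂ) * Complex.exp (-(θ : ℝ) * Complex.I)) := by
      rw [neg_mul, Complex.exp_neg]
      have := Complex.exp_ne_zero (θ * Complex.I)
      field_simp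
    rw [this, norm_mul, Complex.norm_exp_ofReal_mul_I, one_mul]
  rw [h1]
  refine le_trans ?_ (Complex.abs_im_le_norm _)
  simp [Complex.exp_ofReal_mul_I_im, le_abs_self]

theorem tendsto_im_one_add_cpow_div (θ lam : ℝ) :
    Tendsto (fun y : ℝ => ((1 + (y : ℂ) * Complex.exp (-(θ : ℝ) * Complex.I)) ^
      (-(lam : ℂ))).im / Real.pi / y) (𝓝[>] 0) (𝓝 (lam * Real.sin θ / Real.pi)) := by
  set e := Complex.exp (-(θ : ℝ) * Complex.I) with he
  have h1 : HasDerivAt (fun y : ℂ => (1 + y * e) ^ (-(lam : ℂ))) (-(lam : ℂ) * e) ((0 : ℝ) : ℂ) := by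
    have h := ((((hasDerivAt_id (0 : ℂ)).mul_const e).const_add 1).cpow_const (c := -(lam : ℂ))
      (by simp))
    simpa using h
  have h2 := h1.comp_ofReal
  have h3 : HasDerivAt (fun y : ℝ => ((1 + (y : ℂ) * e) ^ (-(lam : ℂ))).im)
      (-(lam : ℂ) * e).im 0 := by
    have := Complex.imCLM.hasFDerivAt.comp_hasDerivAt (0 : ℝ) h2
    simpa [Function.comp_def] using this
  have h4 := (h3.div_const Real.pi).tendsto_slope_zero_right
  have h5 : (-(lam : ℂ) * e).im = lam * Real.sin θ := by
    have : e.im = -Real.sin θ := by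
      rw [he, ← Complex.ofReal_neg, Complex.exp_ofReal_mul_I_im, Real.sin_neg]
    rw [← Complex.ofReal_neg, Complex.im_ofReal_mul, this]
    ring
  rw [h5] at h4
  refine h4.congr fun y => ?_
  simp [div_eq_inv_mul]

/-- Near y = 0 the derivative there controls the quotient; away from 0 the function is bounded,
since the base has norm at least sin θ. With y = s^(-β) this gives a bound on the density for all s
> 0. -/
theorem exists_im_one_add_cpow_le {θ lam : ℝ} (hθ : θ ∈ Ioo 0 Real.pi) (hlam : 0 < lam) :
    ∃ C : ℝ, 0 < C ∧ ∀ y : ℝ, 0 < y → ((1 + (y : ℂ) * Complex.exp (-(θ : ℝ) * Complex.I)) ^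
      (-(lam : ℂ))).im / Real.pi ≤ C * y := by
  have hsin := Real.sin_pos_of_mem_Ioo hθ
  have hpi := Real.pi_pos
  set K := lam * Real.sin θ / Real.pi
  have hK : 0 < K := by positivity
  have hev := (tendsto_im_one_add_cpow_div θ lam).eventually_le_const
    (show K < K + 1 by linarith)
  obtain ⟨η, hη, hη'⟩ := mem_nhdsGT_iff_exists_Ioo_subset.1 hev
  have hη0 : (0 : ℝ) < η := hη
  set M := (Real.sin θ) ^ (-lam) / Real.pi
  have hM : 0 < M := by positivity
  refine ⟨K + 1 + M / η, by positivity, fun y hy => ?_⟩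
  by_cases hyη : y < η
  · have h := hη' ⟨hy, hyη⟩
    simp only [Set.mem_ofPred_eq] at h
    rw [div_le_iff₀ hy] at h
    have : 0 ≤ M / η * y := by positivity
    nlinarith
  · push Not at hyη
    have h1 : ((1 + (y : ℂ) * Complex.exp (-(θ : ℝ) * Complex.I)) ^
        (-(lam : ℂ))).im ≤ (Real.sin θ) ^ (-lam) := by
      refine (le_abs_self _).trans ((Complex.abs_im_le_norm _).trans ?_)
      rw [← Complex.ofReal_neg lam, Complex.norm_cpow_real]
      exact Real.rpow_le_rpow_of_nonpos hsin (sin_le_norm_one_add y) (by linarith)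
    have h2 : M ≤ M / η * y := by
      rw [div_mul_eq_mul_div, le_div_iff₀ hη0]
      nlinarith
    have h3 : ((1 + (y : ℂ) * Complex.exp (-(θ : ℝ) * Complex.I)) ^
      (-(lam : ℂ))).im / Real.pi ≤ M := div_le_div_of_nonneg_right h1 hpi.le
    nlinarith

theorem exists_dagumDensity_le {β lam : ℝ} (hβ : β ∈ Ioo (0 : ℝ) 1) (hlam : 0 < lam) :
    ∃ C : ℝ, 0 < C ∧ ∀ s : ℝ, 0 < s → dagumDensity β lam s ≤ C * s ^ (-β) := by
  have hpi := Real.pi_pos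
  obtain ⟨C, hC, h⟩ := exists_im_one_add_cpow_le (θ := Real.pi * β) (lam := lam)
    ⟨by nlinarith [hβ.1], by nlinarith [hβ.2]⟩ hlam
  exact ⟨C, hC, fun s hs => h _ (by positivity)⟩

theorem tendsto_dagumDensity_div {β : ℝ} (hβ : 0 < β) (lam : ℝ) :
    Tendsto (fun s => dagumDensity β lam s / s ^ (-β)) atTop
      (𝓝 (lam * Real.sin (Real.pi * β) / Real.pi)) := by
  refine (tendsto_im_one_add_cpow_div (Real.pi * β) lam).comp ?_
  refine tendsto_nhdsWithin_iff.2 ⟨tendsto_rpow_neg_atTop hβ, ?_⟩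
  filter_upwards [eventually_gt_atTop 0] with s hs
  exact Real.rpow_pos_of_pos hs _

/-! ### The Gaussian mixing density -/

/-- The Laplace transform of `dagumDensity`. -/
noncomputable def dagumMixing (β lam τ : ℝ) : ℝ :=
  ∫ s in Ioi 0, dagumDensity β lam s * Real.exp (-(τ * s))

theorem dagumMixing_nonneg {β lam : ℝ} (hβ : β ∈ Ioo (0 : ℝ) 1) (hlam : 0 < lam)
    (hβlam : β * lam ≤ 1) (τ : ℝ) : 0 ≤ dagumMixing β lam τ :=
  setIntegral_nonneg measurableSet_Ioi fun _ hs =>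
    mul_nonneg (dagumDensity_nonneg hβ hlam hβlam hs) (Real.exp_pos _).le

theorem integrableOn_rpow_mul_exp_neg_mul {a r : ℝ} (ha : 0 < a) (hr : 0 < r) :
    IntegrableOn (fun t : ℝ => t ^ (a - 1) * Real.exp (-(r * t))) (Ioi 0) := by
  have := integrableOn_rpow_mul_exp_neg_mul_rpow (s := a - 1) (p := 1) (by linarith) one_pos hr
  simpa using this

theorem exists_dagumMixing_le {β lam : ℝ} (hβ : β ∈ Ioo (0 : ℝ) 1) (hlam : 0 < lam)
    (hβlam : β * lam ≤ 1) :
    ∃ C : ℝ, 0 < C ∧ ∀ τ : ℝ, 0 < τ → dagumMixing β lam τ ≤ C * τ ^ (β - 1) := by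
  obtain ⟨C, hC, h⟩ := exists_dagumDensity_le hβ hlam
  have h1β : 0 < 1 - β := by linarith [hβ.2]
  refine ⟨C * Real.Gamma (1 - β), mul_pos hC (Real.Gamma_pos_of_pos h1β), fun τ hτ => ?_⟩
  have hi := (integrableOn_rpow_mul_exp_neg_mul h1β hτ).const_mul C
  have hle : dagumMixing β lam τ ≤
      ∫ s in Ioi 0, C * (s ^ (1 - β - 1) * Real.exp (-(τ * s))) := by
    refine integral_mono_of_nonneg ?_ hi ?_
    · filter_upwards [ae_restrict_mem measurableSet_Ioi] with s hs
      exact mul_nonneg (dagumDensity_nonneg hβ hlam hβlam hs) (Real.exp_pos _).le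
    · filter_upwards [ae_restrict_mem measurableSet_Ioi] with s hs
      rw [← mul_assoc]
      gcongr
      rw [show 1 - β - 1 = -β by ring]
      exact h s hs
  rw [integral_const_mul, Real.integral_rpow_mul_exp_neg_mul_Ioi h1β hτ, one_div,
    Real.inv_rpow hτ.le, ← Real.rpow_neg hτ.le, neg_sub] at hle
  linarith

/-- An Abelian theorem: the substitution s = x/τ moves the tail of the density at infinity to τ → 0,
under a domination by a gamma integrand. -/
theorem tendsto_dagumMixing {β lam : ℝ} (hβ : β ∈ Ioo (0 : ℝ) 1) (hlam : 0 < lam)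
    (hβlam : β * lam ≤ 1) :
    Tendsto (fun τ => τ ^ (1 - β) * dagumMixing β lam τ) (𝓝[>] 0)
      (𝓝 (lam / Real.Gamma β)) := by
  obtain ⟨C, hC, h⟩ := exists_dagumDensity_le hβ hlam
  have h1β : 0 < 1 - β := by linarith [hβ.2]
  have hval : lam / Real.Gamma β = ∫ x in Ioi 0, (lam * Real.sin (Real.pi * β) / Real.pi) *
      (x ^ (1 - β - 1) * Real.exp (-(1 * x))) := by
    rw [integral_const_mul, Real.integral_rpow_mul_exp_neg_mul_Ioi h1β one_pos]
    -- The reflection formula turns sin(πβ) Γ(1 - β)/π into 1/Γ(β).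
    have hr := Real.Gamma_mul_Gamma_one_sub β
    have hsin : Real.sin (Real.pi * β) ≠ 0 := (Real.sin_pos_of_mem_Ioo
      ⟨by nlinarith [hβ.1, Real.pi_pos], by nlinarith [hβ.2, Real.pi_pos]⟩).ne'
    have hG := (Real.Gamma_pos_of_pos hβ.1).ne'
    have hpi := Real.pi_ne_zero
    simp only [div_one, Real.one_rpow, one_mul]
    rw [eq_div_iff hsin] at hr
    rw [div_eq_iff hG]
    field_simp
    linear_combination -hr
  have hsub : ∀ τ : ℝ, 0 < τ → τ ^ (1 - β) * dagumMixing β lam τ =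
      ∫ x in Ioi 0, τ ^ (-β) * dagumDensity β lam (x / τ) * Real.exp (-(1 * x)) := by
    intro τ hτ
    have h1 := integral_comp_mul_left_Ioi
      (fun x => dagumDensity β lam (x / τ) * Real.exp (-x)) 0 hτ
    simp only [mul_zero, mul_div_cancel_left₀ _ hτ.ne', smul_eq_mul] at h1
    simp only [mul_assoc, one_mul]
    rw [integral_const_mul, dagumMixing, h1, ← mul_assoc]
    congr 1
    rw [show 1 - β = -β + 1 by ring, Real.rpow_add_one hτ.ne']
    field_simp
  rw [hval]
  refine Tendsto.congr' (f₁ := fun τ => ∫ x in Ioi 0, τ ^ (-β) * dagumDensity β lam (x / τ) *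
    Real.exp (-(1 * x))) ?_ ?_
  · filter_upwards [self_mem_nhdsWithin] with τ hτ
    exact (hsub τ hτ).symm
  have hkey : ∀ τ x : ℝ, 0 < τ → 0 < x → τ ^ (-β) * (x / τ) ^ (-β) = x ^ (1 - β - 1) := by
    intro τ x hτ hx
    rw [← Real.mul_rpow hτ.le (by positivity), mul_div_cancel₀ _ hτ.ne',
      show 1 - β - 1 = -β by ring]
  refine tendsto_integral_filter_of_dominated_convergence
    (fun x => C * (x ^ (1 - β - 1) * Real.exp (-(1 * x)))) ?_ ?_
    ((integrableOn_rpow_mul_exp_neg_mul h1β one_pos).const_mul C) ?_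
  · refine Eventually.of_forall fun τ => Measurable.aestronglyMeasurable ?_
    exact (((measurable_dagumDensity β lam).comp (by fun_prop)).const_mul _).mul (by fun_prop)
  · filter_upwards [self_mem_nhdsWithin] with τ (hτ : 0 < τ)
    filter_upwards [ae_restrict_mem measurableSet_Ioi] with x (hx : 0 < x)
    have hρ := dagumDensity_nonneg hβ hlam hβlam (div_pos hx hτ)
    rw [Real.norm_of_nonneg (by positivity), ← mul_assoc]
    refine mul_le_mul_of_nonneg_right ?_ (Real.exp_pos _).le
    rw [← hkey τ x hτ hx]
    calc _ ≤ τ ^ (-β) * (C * (x / τ) ^ (-β)) := by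
          gcongr
          exact h _ (div_pos hx hτ)
      _ = _ := by ring
  · filter_upwards [ae_restrict_mem measurableSet_Ioi] with x (hx : 0 < x)
    have hd : Tendsto (fun τ : ℝ => x / τ) (𝓝[>] 0) atTop := by
      simp only [div_eq_mul_inv]
      exact tendsto_inv_nhdsGT_zero.const_mul_atTop hx
    have := (((tendsto_dagumDensity_div hβ.1 lam).comp hd).mul_const
      (x ^ (1 - β - 1) * Real.exp (-(1 * x))))
    refine this.congr' ?_
    filter_upwards [self_mem_nhdsWithin] with τ (hτ : 0 < τ)
    simp only [Function.comp]
    rw [← hkey τ x hτ hx]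
    have : (x / τ) ^ (-β) ≠ 0 := (Real.rpow_pos_of_pos (div_pos hx hτ) _).ne'
    field_simp

/-- `t ↦ 1 - (1 + t ^ (-β)) ^ (-lam)` is the Laplace transform of `dagumMixing`. -/
theorem integrableOn_and_integral_exp_mul_dagumMixing {β lam : ℝ} (hβ : β ∈ Ioo (0 : ℝ) 1)
    (hlam : 0 < lam) (hβlam : β * lam ≤ 1) {t : ℝ} (ht : 0 < t) :
    IntegrableOn (fun τ => Real.exp (-(t * τ)) * dagumMixing β lam τ) (Ioi 0) ∧
      ∫ τ in Ioi 0, Real.exp (-(t * τ)) * dagumMixing β lam τ = 1 - (1 + t ^ (-β)) ^ (-lam) := by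
  obtain ⟨hi, hv⟩ := integrableOn_and_integral_dagumDensity_div hβ hlam hβlam ht
  have hinner : ∀ s : ℝ, 0 < s → ∫ τ in Ioi (0 : ℝ),
      dagumDensity β lam s * Real.exp (-((s + t) * τ)) = dagumDensity β lam s / (s + t) := by
    intro s hs
    rw [integral_const_mul]
    have := integral_exp_mul_Ioi (a := -(s + t)) (by linarith) 0
    simp only [neg_mul, mul_zero, Real.exp_zero, neg_div_neg_eq] at this
    rw [this]
    ring
  have hinti : ∀ s : ℝ, 0 < s → IntegrableOn (fun τ =>
      dagumDensity β lam s * Real.exp (-((s + t) * τ))) (Ioi 0) := by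
    intro s hs
    have := integrableOn_exp_mul_Ioi (a := -(s + t)) (by linarith) 0
    simp only [neg_mul] at this
    exact this.const_mul _
  have hprod : Integrable (fun p : ℝ × ℝ =>
      dagumDensity β lam p.1 * Real.exp (-((p.1 + t) * p.2)))
      ((volume.restrict (Ioi 0)).prod (volume.restrict (Ioi 0))) := by
    rw [integrable_prod_iff]
    · constructor
      · filter_upwards [ae_restrict_mem measurableSet_Ioi] with s hs
        exact hinti s hs
      · refine hi.congr ?_
        filter_upwards [ae_restrict_mem measurableSet_Ioi] with s hs
        rw [← hinner s hs]
        refine integral_congr_ae (ae_of_all _ fun τ => ?_)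
        exact (Real.norm_of_nonneg (mul_nonneg (dagumDensity_nonneg hβ hlam hβlam hs)
          (Real.exp_pos _).le)).symm
    · refine Measurable.aestronglyMeasurable ?_
      exact ((measurable_dagumDensity β lam).comp measurable_fst).mul (by fun_prop)
  have hfac : ∀ τ : ℝ, ∫ s in Ioi 0, dagumDensity β lam s * Real.exp (-((s + t) * τ)) =
      Real.exp (-(t * τ)) * dagumMixing β lam τ := by
    intro τ
    rw [dagumMixing, ← integral_const_mul]
    refine integral_congr_ae (ae_of_all _ fun s => ?_)
    simp only
    rw [show -((s + t) * τ) = -(t * τ) + -(τ * s) by ring, Real.exp_add]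
    ring
  constructor
  · have := hprod.integral_prod_right
    simp only [hfac] at this
    exact this
  · have := integral_integral_swap
      (f := fun s τ => dagumDensity β lam s * Real.exp (-((s + t) * τ))) hprod
    simp only [hfac] at this
    rw [← this, ← hv]
    refine setIntegral_congr_fun measurableSet_Ioi fun s hs => ?_
    exact hinner s hs

theorem measurable_dagumMixing (β lam : ℝ) : Measurable (dagumMixing β lam) := by
  refine StronglyMeasurable.measurable ?_
  refine StronglyMeasurable.integral_prod_right
    (f := fun τ s => dagumDensity β lam s * Real.exp (-(τ * s))) (Measurable.stronglyMeasurable ?_)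
  exact ((measurable_dagumDensity β lam).comp measurable_snd).mul (by fun_prop)

/-- On (0, 1/t] one has exp(-tτ) ≥ e⁻¹, so the mass there is at most e times the Laplace transform
at t, which is at most 1. Letting t → 0 along 1/(n + 1) bounds the total mass by e. -/
theorem integrableOn_dagumMixing {β lam : ℝ} (hβ : β ∈ Ioo (0 : ℝ) 1)
    (hlam : 0 < lam) (hβlam : β * lam ≤ 1) : IntegrableOn (dagumMixing β lam) (Ioi 0) := by
  have hbound : ∀ t : ℝ, 0 < t → ∀ τ ∈ Ioc 0 t⁻¹,
      dagumMixing β lam τ ≤ Real.exp 1 * (Real.exp (-(t * τ)) * dagumMixing β lam τ) := by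
    intro t ht τ hτ
    have hm := dagumMixing_nonneg hβ hlam hβlam τ
    rw [← mul_assoc, ← Real.exp_add]
    refine le_mul_of_one_le_left hm (Real.one_le_exp ?_)
    have : t * τ ≤ 1 := by
      calc t * τ ≤ t * t⁻¹ := by gcongr; exact hτ.2
        _ = 1 := mul_inv_cancel₀ ht.ne'
    linarith
  have hint : ∀ t : ℝ, 0 < t → IntegrableOn (dagumMixing β lam) (Ioc 0 t⁻¹) := by
    intro t ht
    refine Integrable.mono' (((integrableOn_and_integral_exp_mul_dagumMixing hβ hlam hβlam
      ht).1.mono_set Ioc_subset_Ioi_self).const_mul (Real.exp 1))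
      (measurable_dagumMixing β lam).aestronglyMeasurable ?_
    filter_upwards [ae_restrict_mem measurableSet_Ioc] with τ hτ
    rw [Real.norm_of_nonneg (dagumMixing_nonneg hβ hlam hβlam τ)]
    exact hbound t ht τ hτ
  refine integrableOn_Ioi_of_intervalIntegral_norm_bounded (l := atTop) (b := fun n : ℕ =>
    ((n : ℝ) + 1)) (Real.exp 1) 0 (fun n => ?_)
    (tendsto_natCast_atTop_atTop.atTop_add tendsto_const_nhds) (Eventually.of_forall fun n => ?_)
  · simpa using hint ((n : ℝ) + 1)⁻¹ (by positivity)
  · have hn : (0 : ℝ) < ((n : ℝ) + 1)⁻¹ := by positivity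
    obtain ⟨h1, h2⟩ := integrableOn_and_integral_exp_mul_dagumMixing hβ hlam hβlam hn
    rw [intervalIntegral.integral_of_le (by positivity)]
    have hi := hint _ hn
    have hb := hbound _ hn
    rw [inv_inv] at hi hb
    calc _ ≤ ∫ τ in Ioc 0 ((n : ℝ) + 1), Real.exp 1 *
          (Real.exp (-(((n : ℝ) + 1)⁻¹ * τ)) * dagumMixing β lam τ) := by
          refine setIntegral_mono_on hi.norm
            ((h1.mono_set Ioc_subset_Ioi_self).const_mul _) measurableSet_Ioc fun τ hτ => ?_
          rw [Real.norm_of_nonneg (dagumMixing_nonneg hβ hlam hβlam τ)]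
          exact hb τ hτ
      _ ≤ ∫ τ in Ioi 0, Real.exp 1 *
          (Real.exp (-(((n : ℝ) + 1)⁻¹ * τ)) * dagumMixing β lam τ) := by
          refine setIntegral_mono_set (h1.const_mul _) ?_ Ioc_subset_Ioi_self.eventuallyLE
          exact ae_of_all _ fun τ => mul_nonneg (Real.exp_pos _).le
            (mul_nonneg (Real.exp_pos _).le (dagumMixing_nonneg hβ hlam hβlam τ))
      _ ≤ Real.exp 1 * 1 := by
          rw [integral_const_mul, h2]
          gcongr
          have : 0 ≤ (1 + (((n : ℝ) + 1)⁻¹) ^ (-β)) ^ (-lam) := by positivity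
          linarith
      _ = _ := mul_one _

/-! ### The Hankel transform of a Gaussian -/

theorem integrable_tsum_of_summable_integral_norm {α : Type*} [MeasurableSpace α] {μ : Measure α}
    {F : ℕ → α → ℝ} (hF : ∀ i, Integrable (F i) μ)
    (hsum : Summable fun i => ∫ a, ‖F i a‖ ∂μ) : Integrable (fun a => ∑' i, F i a) μ := by
  have hlt : ∫⁻ a, ∑' i, ‖F i a‖ₑ ∂μ < ⊤ := by
    rw [lintegral_tsum fun i => (hF i).1.enorm]
    have h : ∀ i, ∫⁻ a, ‖F i a‖ₑ ∂μ = ENNReal.ofReal (∫ a, ‖F i a‖ ∂μ) := fun i =>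
      (ofReal_integral_norm_eq_lintegral_enorm (hF i)).symm
    simp only [h]
    rw [← ENNReal.ofReal_tsum_of_nonneg (fun i => integral_nonneg fun a => norm_nonneg _) hsum]
    exact ENNReal.ofReal_lt_top
  have hmeas : AEMeasurable (fun a => ∑' i, ‖F i a‖ₑ) μ :=
    AEMeasurable.tsum fun i => (hF i).1.enorm
  have hs : ∀ᵐ a ∂μ, Summable fun i => F i a := by
    filter_upwards [ae_lt_top' hmeas hlt.ne] with a ha
    have : Summable fun i => ‖F i a‖₊ := ENNReal.tsum_coe_ne_top_iff_summable.1 ha.ne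
    exact this.of_nnnorm
  refine ⟨?_, ?_⟩
  · refine aestronglyMeasurable_of_tendsto_ae atTop
      (f := fun n a => ∑ i ∈ Finset.range n, F i a) (fun n => ?_) ?_
    · exact (integrable_finsetSum _ fun i _ => hF i).1
    · filter_upwards [hs] with a ha
      exact ha.hasSum.tendsto_sum_nat
  · exact (lintegral_mono fun a => enorm_tsum_le_tsum_enorm).trans_lt hlt

/-- Integrate the Bessel series term by term: the Gaussian moment of the m-th term contributes Γ(m +
a), which cancels the same factor in the coefficient and leaves an exponential series. The absolute
values give the same series without signs, which justifies the interchange. -/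
theorem integrableOn_and_integral_gaussian_mul_besselJ {a p z : ℝ} (ha : 0 < a) (hp : 0 < p)
    (hz : 0 < z) :
    IntegrableOn (fun u => Real.exp (-p * u ^ 2) * (u ^ a * besselJ (a - 1) (u * z))) (Ioi 0) ∧
      ∫ u in Ioi 0, Real.exp (-p * u ^ 2) * (u ^ a * besselJ (a - 1) (u * z)) =
        z ^ (a - 1) * (2 * p) ^ (-a) * Real.exp (-(z ^ 2 / (4 * p))) := by
  have hma : ∀ m : ℕ, 0 < (m : ℝ) + a := fun m => by positivity
  set q : ℕ → ℝ := fun m => 2 * ((m : ℝ) + a) - 1 with hq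
  set c : ℕ → ℝ := fun m => (-1 : ℝ) ^ m / ((m.factorial : ℝ) * Real.Gamma ((m : ℝ) + a)) *
    (z / 2) ^ (2 * (m : ℝ) + (a - 1)) with hc
  set F : ℕ → ℝ → ℝ := fun m u => c m * (u ^ q m * Real.exp (-p * u ^ (2 : ℝ))) with hF
  have hterm : ∀ u ∈ Ioi (0 : ℝ), ∑' m, F m u =
      Real.exp (-p * u ^ 2) * (u ^ a * besselJ (a - 1) (u * z)) := by
    intro u hu
    have hu : 0 < u := hu
    rw [besselJ, ← tsum_mul_left, ← tsum_mul_left]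
    refine tsum_congr fun m => ?_
    simp only [hF, hc, hq, Real.rpow_two]
    rw [show u * z / 2 = u * (z / 2) by ring, Real.mul_rpow hu.le (by positivity),
      show (m : ℝ) + (a - 1) + 1 = m + a by ring,
      show 2 * ((m : ℝ) + a) - 1 = a + (2 * (m : ℝ) + (a - 1)) by ring, Real.rpow_add hu]
    ring
  have hint : ∀ m, IntegrableOn (F m) (Ioi 0) := fun m =>
    (integrableOn_rpow_mul_exp_neg_mul_rpow (by simp only [hq]; linarith [hma m]) two_pos
      hp).const_mul _
  have hval : ∀ m, ∫ u in Ioi (0 : ℝ), u ^ q m * Real.exp (-p * u ^ (2 : ℝ)) =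
      p ^ (-((m : ℝ) + a)) * (1 / 2) * Real.Gamma ((m : ℝ) + a) := by
    intro m
    rw [integral_rpow_mul_exp_neg_mul_rpow two_pos (by simp only [hq]; linarith [hma m]) hp]
    simp only [hq]
    congr 2
    · congr 1
      ring
    · ring
  have hexp : ∀ m : ℕ, (z / 2) ^ (2 * (m : ℝ) + (a - 1)) * p ^ (-((m : ℝ) + a)) * (1 / 2) =
      z ^ (a - 1) * (2 * p) ^ (-a) * (z ^ 2 / (4 * p)) ^ m := by
    intro m
    have h4 : (z / 2) ^ (2 * (m : ℝ)) = (z ^ 2 / 4) ^ m := by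
      rw [Real.rpow_mul (by positivity), Real.rpow_two, Real.rpow_natCast]
      congr 1; ring
    have h5 : p ^ (-(m : ℝ)) = (p⁻¹) ^ m := by
      rw [Real.rpow_neg hp.le, Real.rpow_natCast, inv_pow]
    have h6 : (2 : ℝ) ^ (-(a - 1)) = 2 ^ (-a) * 2 := by
      rw [neg_sub, sub_eq_neg_add, Real.rpow_add two_pos, Real.rpow_one]
    rw [Real.rpow_add (by positivity), h4, neg_add, Real.rpow_add hp, h5,
      Real.div_rpow hz.le two_pos.le, Real.mul_rpow two_pos.le hp.le, div_eq_mul_inv (z ^ (a - 1)),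
      ← Real.rpow_neg two_pos.le, h6, show z ^ 2 / (4 * p) = z ^ 2 / 4 * p⁻¹ by field_simp,
      mul_pow]
    ring
  have hFint : ∀ m, ∫ u in Ioi (0 : ℝ), F m u =
      z ^ (a - 1) * (2 * p) ^ (-a) * ((-(z ^ 2 / (4 * p))) ^ m / (m.factorial : ℝ)) := by
    intro m
    simp only [hF]
    rw [integral_const_mul, hval m]
    have hG := (Real.Gamma_pos_of_pos (hma m)).ne'
    have hf : (m.factorial : ℝ) ≠ 0 := by positivity
    rw [neg_pow (z ^ 2 / (4 * p))]
    calc _ = (-1) ^ m / (m.factorial : ℝ) *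
          ((z / 2) ^ (2 * (m : ℝ) + (a - 1)) * p ^ (-((m : ℝ) + a)) * (1 / 2)) := by
          simp only [hc]
          field_simp
      _ = _ := by rw [hexp m]; ring
  have hnorm : ∀ m, ∫ u in Ioi (0 : ℝ), ‖F m u‖ =
      z ^ (a - 1) * (2 * p) ^ (-a) * ((z ^ 2 / (4 * p)) ^ m / (m.factorial : ℝ)) := by
    intro m
    have hG := Real.Gamma_pos_of_pos (hma m)
    have hf : 0 < (m.factorial : ℝ) := by positivity
    have h1 : ∫ u in Ioi (0 : ℝ), ‖F m u‖ =
        ∫ u in Ioi (0 : ℝ), |c m| * (u ^ q m * Real.exp (-p * u ^ (2 : ℝ))) := by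
      refine setIntegral_congr_fun measurableSet_Ioi fun u hu => ?_
      have hu : 0 < u := hu
      simp only [hF]
      rw [norm_mul, Real.norm_eq_abs, Real.norm_of_nonneg (by positivity)]
    have h2 : |c m| = 1 / ((m.factorial : ℝ) * Real.Gamma ((m : ℝ) + a)) *
        (z / 2) ^ (2 * (m : ℝ) + (a - 1)) := by
      simp only [hc]
      rw [abs_mul, abs_div, abs_pow, abs_neg, abs_one, one_pow, abs_of_pos (mul_pos hf hG),
        abs_of_pos (by positivity)]
    rw [h1, integral_const_mul, hval m, h2]
    calc _ = 1 / (m.factorial : ℝ) *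
          ((z / 2) ^ (2 * (m : ℝ) + (a - 1)) * p ^ (-((m : ℝ) + a)) * (1 / 2)) := by
          field_simp
      _ = _ := by rw [hexp m]; ring
  have hsum : Summable fun m => ∫ u in Ioi (0 : ℝ), ‖F m u‖ := by
    simp only [hnorm]
    exact (Real.summable_pow_div_factorial _).mul_left _
  constructor
  · exact (integrable_tsum_of_summable_integral_norm hint hsum).congr
      ((ae_restrict_mem measurableSet_Ioi).mono hterm)
  · rw [← setIntegral_congr_fun measurableSet_Ioi hterm,
      ← integral_tsum_of_summable_integral_norm hint hsum]
    simp only [hFint]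
    rw [tsum_mul_left, Real.exp_eq_exp_ℝ, NormedSpace.exp_eq_tsum_div]

/-! ### The spectral density as a mixture of heat kernels -/

/-- The Gaussian kernel at distance `z` and time `σ` in dimension `2 a`. -/
noncomputable def heatKernel (a z σ : ℝ) : ℝ :=
  (4 * Real.pi * σ) ^ (-a) * Real.exp (-(z ^ 2 / (4 * σ)))

theorem heatKernel_nonneg (a z : ℝ) {σ : ℝ} (hσ : 0 < σ) : 0 ≤ heatKernel a z σ := by
  have := Real.pi_pos
  unfold heatKernel
  positivity

theorem measurable_heatKernel (a z : ℝ) : Measurable (heatKernel a z) := by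
  unfold heatKernel
  fun_prop

theorem continuousAt_heatKernel (a z : ℝ) {σ : ℝ} (hσ : 0 < σ) :
    ContinuousAt (heatKernel a z) σ := by
  have := Real.pi_pos
  unfold heatKernel
  refine ContinuousAt.mul (ContinuousAt.rpow_const (by fun_prop) (Or.inl (by positivity))) ?_
  refine Real.continuous_exp.continuousAt.comp (ContinuousAt.neg ?_)
  exact ContinuousAt.div (by fun_prop) (by fun_prop) (by positivity)

/-- A bound uniform in time, from y/a ≤ exp(y/a) with y = z²/(4σ). It supplies the dominating
function as ε → 0. -/
theorem heatKernel_le {a z σ : ℝ} (ha : 0 < a) (hz : 0 < z) (hσ : 0 < σ) :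
    heatKernel a z σ ≤ (a / (Real.pi * z ^ 2)) ^ a := by
  have hpi := Real.pi_pos
  set y := z ^ 2 / (4 * σ) with hy
  have hy0 : 0 < y := by positivity
  have h1 : (y / a) ^ a ≤ Real.exp y := by
    calc (y / a) ^ a ≤ (Real.exp (y / a)) ^ a := by
          gcongr
          linarith [Real.add_one_le_exp (y / a)]
      _ = Real.exp y := by
          rw [← Real.exp_mul, div_mul_cancel₀ _ ha.ne']
  have h2 : Real.exp (-y) ≤ (a / y) ^ a := by
    rw [Real.exp_neg, ← inv_div y a, Real.inv_rpow (by positivity)]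
    exact inv_anti₀ (by positivity) h1
  calc heatKernel a z σ ≤ (4 * Real.pi * σ) ^ (-a) * (a / y) ^ a := by
        unfold heatKernel; gcongr
    _ = (a / (Real.pi * z ^ 2)) ^ a := by
        rw [Real.rpow_neg (by positivity), ← Real.inv_rpow (by positivity),
          ← Real.mul_rpow (by positivity) (by positivity)]
        congr 1
        rw [hy]
        field_simp

theorem dagum_eq {lam δ u : ℝ} (hu : 0 < u) :
    dagum lam δ u = 1 - (1 + (u ^ 2) ^ (-(δ / 2))) ^ (-lam) := by
  unfold dagum
  have h1 : (u ^ 2) ^ (-(δ / 2)) = (u ^ δ)⁻¹ := by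
    rw [← Real.rpow_two, ← Real.rpow_mul hu.le, ← Real.rpow_neg hu.le]
    congr 1; ring
  have hp : 0 < u ^ δ := by positivity
  rw [h1, Real.rpow_neg (by positivity), ← Real.inv_rpow (by positivity)]
  congr 2
  field_simp
  ring

theorem dagum_mem_Icc {lam δ u : ℝ} (hlam : 0 ≤ lam) (hu : 0 < u) :
    dagum lam δ u ∈ Icc 0 1 := by
  rw [dagum_eq hu]
  have h1 : (1 : ℝ) ≤ 1 + (u ^ 2) ^ (-(δ / 2)) := by
    have : 0 ≤ (u ^ 2) ^ (-(δ / 2)) := by positivity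
    linarith
  have h2 := Real.rpow_le_one_of_one_le_of_nonpos h1 (neg_nonpos.2 hlam)
  have h3 : 0 ≤ (1 + (u ^ 2) ^ (-(δ / 2))) ^ (-lam) := by positivity
  exact ⟨by linarith, by linarith⟩

theorem measurable_dagum (lam δ : ℝ) : Measurable (dagum lam δ) := by
  unfold dagum
  fun_prop

theorem integrableOn_exp_mul_hankelIntegrand {d : ℕ} (hd : 1 ≤ d) {δ lam z ε : ℝ}
    (hlam : 0 < lam) (hz : 0 < z) (hε : 0 < ε) :
    IntegrableOn (fun u => Real.exp (-ε * u ^ 2) * hankelIntegrand d (dagum lam δ) z u)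
      (Ioi 0) := by
  have ha : 0 < (d : ℝ) / 2 := by positivity
  have h := (integrableOn_and_integral_gaussian_mul_besselJ ha hε hz).1
  refine (h.mul_bdd (c := 1) (measurable_dagum lam δ).aestronglyMeasurable ?_).congr
    (ae_of_all _ fun u => ?_)
  · filter_upwards [ae_restrict_mem measurableSet_Ioi] with u hu
    have := dagum_mem_Icc (δ := δ) hlam.le hu
    rw [Real.norm_of_nonneg this.1]
    exact this.2
  · simp only [hankelIntegrand, mul_assoc]

/-- The regularized transform of the Dagum function as a mixture of Gaussian kernels. -/
theorem regularizedHankel_dagum {d : ℕ} (hd : 1 ≤ d) {δ lam z ε : ℝ} (hδ : δ ∈ Ioo (0 : ℝ) 2)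
    (hlam : 0 < lam) (hδlam : δ * lam ≤ 2) (hz : 0 < z) (hε : 0 < ε) :
    regularizedHankel d (dagum lam δ) z ε =
      ∫ τ in Ioi 0, heatKernel ((d : ℝ) / 2) z (τ + ε) * dagumMixing (δ / 2) lam τ := by
  have hpi := Real.pi_pos
  have hβ : δ / 2 ∈ Ioo (0 : ℝ) 1 := ⟨by linarith [hδ.1], by linarith [hδ.2]⟩
  have hβlam : δ / 2 * lam ≤ 1 := by linarith
  set a : ℝ := (d : ℝ) / 2 with ha'
  have ha : 0 < a := by positivity
  set m := dagumMixing (δ / 2) lam with hm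
  set k : ℝ → ℝ := fun u => u ^ a * besselJ (a - 1) (u * z) with hk
  have hmnn : ∀ τ, 0 ≤ m τ := dagumMixing_nonneg hβ hlam hβlam
  have hL : ∀ u : ℝ, 0 < u → IntegrableOn (fun τ => Real.exp (-(u ^ 2 * τ)) * m τ) (Ioi 0) ∧
      ∫ τ in Ioi 0, Real.exp (-(u ^ 2 * τ)) * m τ = dagum lam δ u := by
    intro u hu
    rw [dagum_eq hu]
    exact integrableOn_and_integral_exp_mul_dagumMixing hβ hlam hβlam (by positivity)
  have hI := integrableOn_exp_mul_hankelIntegrand hd (δ := δ) hlam hz hε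
  -- The mixing density is nonnegative, so integrating absolute values in τ returns the Dagum
  -- function itself; what remains is the regularized integrand, already known to be integrable.
  have hprod : Integrable (fun x : ℝ × ℝ =>
      (Real.exp (-ε * x.1 ^ 2) * k x.1) * (Real.exp (-(x.1 ^ 2 * x.2)) * m x.2))
      ((volume.restrict (Ioi 0)).prod (volume.restrict (Ioi 0))) := by
    rw [integrable_prod_iff]
    · constructor
      · filter_upwards [ae_restrict_mem measurableSet_Ioi] with u hu
        exact (hL u hu).1.const_mul _
      · refine hI.norm.congr ?_
        filter_upwards [ae_restrict_mem measurableSet_Ioi] with u hu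
        simp only [norm_mul _ (Real.exp _ * m _)]
        rw [integral_const_mul]
        have : ∀ τ, ‖Real.exp (-(u ^ 2 * τ)) * m τ‖ = Real.exp (-(u ^ 2 * τ)) * m τ :=
          fun τ => Real.norm_of_nonneg (mul_nonneg (Real.exp_pos _).le (hmnn τ))
        simp only [this]
        rw [(hL u hu).2, hankelIntegrand, ← mul_assoc, norm_mul,
          Real.norm_of_nonneg (dagum_mem_Icc hlam.le hu).1]
    · refine AEStronglyMeasurable.mul
        (integrableOn_and_integral_gaussian_mul_besselJ ha hε hz).1.1.comp_fst
        (Measurable.aestronglyMeasurable ?_)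
      exact Measurable.mul (by fun_prop) ((measurable_dagumMixing _ _).comp measurable_snd)
  have hswap := integral_integral_swap (f := fun u τ =>
      (Real.exp (-ε * u ^ 2) * k u) * (Real.exp (-(u ^ 2 * τ)) * m τ)) hprod
  have hleft : ∫ u in Ioi (0 : ℝ), Real.exp (-ε * u ^ 2) * hankelIntegrand d (dagum lam δ) z u =
      ∫ u in Ioi (0 : ℝ), ∫ τ in Ioi (0 : ℝ),
        (Real.exp (-ε * u ^ 2) * k u) * (Real.exp (-(u ^ 2 * τ)) * m τ) := by
    refine setIntegral_congr_fun measurableSet_Ioi fun u hu => ?_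
    rw [integral_const_mul, (hL u hu).2, hankelIntegrand, ← mul_assoc]
  rw [regularizedHankel, hleft, hswap, ← integral_const_mul]
  refine setIntegral_congr_fun measurableSet_Ioi fun τ hτ => ?_
  have hτε : 0 < τ + ε := add_pos hτ hε
  have hinner : ∫ u in Ioi (0 : ℝ), (Real.exp (-ε * u ^ 2) * k u) *
      (Real.exp (-(u ^ 2 * τ)) * m τ) =
      m τ * (z ^ (a - 1) * (2 * (τ + ε)) ^ (-a) * Real.exp (-(z ^ 2 / (4 * (τ + ε))))) := by
    rw [← (integrableOn_and_integral_gaussian_mul_besselJ ha hτε hz).2, ← integral_const_mul]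
    refine integral_congr_ae (ae_of_all _ fun u => ?_)
    simp only
    rw [show -(τ + ε) * u ^ 2 = -ε * u ^ 2 + -(u ^ 2 * τ) by ring, Real.exp_add]
    ring
  rw [hinner, heatKernel]
  have h1 : z ^ (1 - a) * z ^ (a - 1) = 1 := by
    rw [← Real.rpow_add hz]; simp
  have h2 : (4 * Real.pi * (τ + ε)) ^ (-a) = ((2 * Real.pi) ^ a)⁻¹ * (2 * (τ + ε)) ^ (-a) := by
    rw [← Real.rpow_neg (by positivity), ← Real.mul_rpow (by positivity) (by positivity)]
    congr 1; ring
  rw [h2]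
  linear_combination (((2 * Real.pi) ^ a)⁻¹ * m τ * (2 * (τ + ε)) ^ (-a) *
    Real.exp (-(z ^ 2 / (4 * (τ + ε))))) * h1

theorem tendsto_regularizedHankel_dagum {d : ℕ} (hd : 1 ≤ d) {δ lam z : ℝ}
    (hδ : δ ∈ Ioo (0 : ℝ) 2) (hlam : 0 < lam) (hδlam : δ * lam ≤ 2) (hz : 0 < z) :
    Tendsto (regularizedHankel d (dagum lam δ) z) (𝓝[>] 0)
      (𝓝 (∫ τ in Ioi 0, heatKernel ((d : ℝ) / 2) z τ * dagumMixing (δ / 2) lam τ)) := by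
  have hβ : δ / 2 ∈ Ioo (0 : ℝ) 1 := ⟨by linarith [hδ.1], by linarith [hδ.2]⟩
  have hβlam : δ / 2 * lam ≤ 1 := by linarith
  have ha : 0 < (d : ℝ) / 2 := by positivity
  refine Tendsto.congr' (f₁ := fun ε => ∫ τ in Ioi 0,
    heatKernel ((d : ℝ) / 2) z (τ + ε) * dagumMixing (δ / 2) lam τ) ?_ ?_
  · filter_upwards [self_mem_nhdsWithin] with ε hε
    exact (regularizedHankel_dagum hd hδ hlam hδlam hz hε).symm
  refine tendsto_integral_filter_of_dominated_convergence
    (fun τ => ((d : ℝ) / 2 / (Real.pi * z ^ 2)) ^ ((d : ℝ) / 2) * dagumMixing (δ / 2) lam τ)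
    ?_ ?_ ((integrableOn_dagumMixing hβ hlam hβlam).const_mul _) ?_
  · refine Eventually.of_forall fun ε => Measurable.aestronglyMeasurable ?_
    exact ((measurable_heatKernel _ _).comp (by fun_prop)).mul (measurable_dagumMixing _ _)
  · filter_upwards [self_mem_nhdsWithin] with ε (hε : 0 < ε)
    filter_upwards [ae_restrict_mem measurableSet_Ioi] with τ (hτ : 0 < τ)
    have hm := dagumMixing_nonneg hβ hlam hβlam τ
    rw [Real.norm_of_nonneg (mul_nonneg (heatKernel_nonneg _ _ (add_pos hτ hε)) hm)]
    exact mul_le_mul_of_nonneg_right (heatKernel_le ha hz (add_pos hτ hε)) hm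
  · filter_upwards [ae_restrict_mem measurableSet_Ioi] with τ (hτ : 0 < τ)
    refine Tendsto.mul_const _ ?_
    refine (continuousAt_heatKernel ((d : ℝ) / 2) z hτ).tendsto.comp ?_
    have : Tendsto (fun ε : ℝ => τ + ε) (𝓝 0) (𝓝 (τ + 0)) :=
      (continuous_const.add continuous_id).tendsto 0
    rw [add_zero] at this
    exact this.mono_left nhdsWithin_le_nhds

/-! ### Low frequencies when δ < d -/

theorem integrableOn_and_integral_heatKernel_one_mul_rpow {a β : ℝ} (hβa : β < a) :
    IntegrableOn (fun σ => heatKernel a 1 σ * σ ^ (β - 1)) (Ioi 0) ∧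
      ∫ σ in Ioi 0, heatKernel a 1 σ * σ ^ (β - 1) =
        Real.pi ^ (-a) * 4 ^ (-β) * Real.Gamma (a - β) := by
  have hpi := Real.pi_pos
  have hab : 0 < a - β := by linarith
  set g : ℝ → ℝ := fun v => (4 * Real.pi) ^ (-a) * (v ^ (a - β - 1) * Real.exp (-(1 / 4 * v)))
    with hg
  have hgi : IntegrableOn g (Ioi 0) :=
    (integrableOn_rpow_mul_exp_neg_mul hab (by norm_num)).const_mul _
  have hfun : ∀ σ ∈ Ioi (0 : ℝ), (|(-1 : ℝ)| * σ ^ ((-1 : ℝ) - 1)) • g (σ ^ (-1 : ℝ)) =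
      heatKernel a 1 σ * σ ^ (β - 1) := by
    intro σ hσ
    have hσ : 0 < σ := hσ
    simp only [hg, heatKernel, abs_neg, abs_one, one_mul, smul_eq_mul, one_pow]
    rw [Real.mul_rpow (by positivity) hσ.le, ← Real.rpow_mul hσ.le, Real.rpow_neg_one,
      show (1 : ℝ) / (4 * σ) = 1 / 4 * σ⁻¹ by field_simp]
    have : σ ^ ((-1 : ℝ) - 1) * σ ^ (-1 * (a - β - 1)) = σ ^ (-a) * σ ^ (β - 1) := by
      rw [← Real.rpow_add hσ, ← Real.rpow_add hσ]
      congr 1; ring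
    linear_combination ((4 * Real.pi) ^ (-a) * Real.exp (-(1 / 4 * σ⁻¹))) * this
  constructor
  · exact ((integrableOn_Ioi_comp_rpow_iff g (p := -1) (by norm_num)).2 hgi).congr
      ((ae_restrict_mem measurableSet_Ioi).mono hfun)
  · rw [← setIntegral_congr_fun measurableSet_Ioi hfun, integral_comp_rpow_Ioi g (by norm_num)]
    simp only [hg]
    rw [integral_const_mul, Real.integral_rpow_mul_exp_neg_mul_Ioi hab (by norm_num),
      Real.mul_rpow (by norm_num) hpi.le, ← mul_assoc]
    congr 1
    norm_num
    rw [sub_eq_add_neg a β, Real.rpow_add (by norm_num), Real.rpow_neg (by norm_num) a]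
    field_simp

theorem heatKernel_sq_mul {a z σ : ℝ} (hz : 0 < z) (hσ : 0 < σ) :
    heatKernel a z (z ^ 2 * σ) = (z ^ 2) ^ (-a) * heatKernel a 1 σ := by
  have hpi := Real.pi_pos
  unfold heatKernel
  rw [show 4 * Real.pi * (z ^ 2 * σ) = z ^ 2 * (4 * Real.pi * σ) by ring,
    Real.mul_rpow (by positivity) (by positivity),
    show z ^ 2 / (4 * (z ^ 2 * σ)) = 1 ^ 2 / (4 * σ) by field_simp]
  ring

/-- Under τ = z²σ the heat kernel scales out and the mixing density is sampled at z²σ → 0, where it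
behaves like a power. The global bound by a multiple of τ^(β-1) gives the domination, integrable
because β < a. -/
theorem tendsto_rpow_mul_integral_heatKernel_mul_dagumMixing {a β lam : ℝ}
    (hβ : β ∈ Ioo (0 : ℝ) 1) (hβa : β < a) (hlam : 0 < lam) (hβlam : β * lam ≤ 1) :
    Tendsto (fun z : ℝ => (z ^ 2) ^ (a - β) * ∫ τ in Ioi 0, heatKernel a z τ *
      dagumMixing β lam τ) (𝓝[>] 0)
      (𝓝 (lam / Real.Gamma β * (Real.pi ^ (-a) * 4 ^ (-β) * Real.Gamma (a - β)))) := by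
  obtain ⟨hi, hv⟩ := integrableOn_and_integral_heatKernel_one_mul_rpow hβa
  obtain ⟨C, hC, hCle⟩ := exists_dagumMixing_le hβ hlam hβlam
  have hpow : ∀ τ : ℝ, 0 < τ → τ ^ (β - 1) * τ ^ (1 - β) = 1 := by
    intro τ hτ
    rw [← Real.rpow_add hτ]; simp
  have hsub : ∀ z : ℝ, 0 < z → (z ^ 2) ^ (a - β) * ∫ τ in Ioi 0, heatKernel a z τ *
      dagumMixing β lam τ = ∫ σ in Ioi 0, ((z ^ 2 * σ) ^ (1 - β) *
        dagumMixing β lam (z ^ 2 * σ)) * (heatKernel a 1 σ * σ ^ (β - 1)) := by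
    intro z hz
    have hz2 : 0 < z ^ 2 := by positivity
    have h1 := integral_comp_mul_left_Ioi
      (fun τ => heatKernel a z τ * dagumMixing β lam τ) 0 hz2
    rw [mul_zero, smul_eq_mul, eq_comm, inv_mul_eq_iff_eq_mul₀ hz2.ne'] at h1
    rw [h1, ← mul_assoc, ← integral_const_mul]
    refine setIntegral_congr_fun measurableSet_Ioi fun σ hσ => ?_
    have hσ : 0 < σ := hσ
    rw [heatKernel_sq_mul hz hσ, Real.mul_rpow hz2.le hσ.le]
    have e1 : (z ^ 2) ^ (a - β) * z ^ 2 * (z ^ 2) ^ (-a) = (z ^ 2) ^ (1 - β) := by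
      rw [← Real.rpow_add_one hz2.ne', ← Real.rpow_add hz2]
      congr 1; ring
    rw [← e1]
    linear_combination (-(z ^ 2) ^ (a - β) * z ^ 2 * (z ^ 2) ^ (-a) * heatKernel a 1 σ *
      dagumMixing β lam (z ^ 2 * σ)) * hpow σ hσ
  rw [← hv, ← integral_const_mul]
  refine Tendsto.congr' (f₁ := fun z => ∫ σ in Ioi 0, ((z ^ 2 * σ) ^ (1 - β) *
        dagumMixing β lam (z ^ 2 * σ)) * (heatKernel a 1 σ * σ ^ (β - 1))) ?_ ?_
  · filter_upwards [self_mem_nhdsWithin] with z hz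
    exact (hsub z hz).symm
  refine tendsto_integral_filter_of_dominated_convergence
    (fun σ => C * (heatKernel a 1 σ * σ ^ (β - 1))) ?_ ?_ (hi.const_mul _) ?_
  · refine Eventually.of_forall fun z => Measurable.aestronglyMeasurable ?_
    have h1 := measurable_heatKernel a 1
    have h2 : Measurable fun σ => dagumMixing β lam (z ^ 2 * σ) :=
      (measurable_dagumMixing β lam).comp (by fun_prop)
    fun_prop
  · filter_upwards [self_mem_nhdsWithin] with z (hz : 0 < z)
    filter_upwards [ae_restrict_mem measurableSet_Ioi] with σ (hσ : 0 < σ)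
    have hm := dagumMixing_nonneg hβ hlam hβlam (z ^ 2 * σ)
    have hk := heatKernel_nonneg a 1 hσ
    rw [Real.norm_of_nonneg (by positivity)]
    refine mul_le_mul_of_nonneg_right ?_ (by positivity)
    have hzσ : 0 < z ^ 2 * σ := by positivity
    calc _ ≤ (z ^ 2 * σ) ^ (1 - β) * (C * (z ^ 2 * σ) ^ (β - 1)) := by
          gcongr
          exact hCle _ hzσ
      _ = C := by linear_combination C * hpow _ hzσ
  · filter_upwards [ae_restrict_mem measurableSet_Ioi] with σ (hσ : 0 < σ)
    refine Tendsto.mul_const _ ((tendsto_dagumMixing hβ hlam hβlam).comp ?_)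
    refine tendsto_nhdsWithin_iff.2 ⟨?_, ?_⟩
    · have : Tendsto (fun z : ℝ => z ^ 2 * σ) (𝓝 0) (𝓝 (0 ^ 2 * σ)) :=
        Continuous.tendsto (by fun_prop) 0
      simp only [ne_eq, OfNat.ofNat_ne_zero, not_false_eq_true, zero_pow, zero_mul] at this
      exact this.mono_left nhdsWithin_le_nhds
    · filter_upwards [self_mem_nhdsWithin] with z (hz : 0 < z)
      exact mul_pos (by positivity) hσ

/-! ### Low frequencies when δ > d -/

/-- The beta integral over the half-line. -/
theorem integrableOn_and_integral_rpow_mul_one_add_rpow {s t : ℝ} (hs : 0 < s) (ht : 0 < t) :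
    IntegrableOn (fun v : ℝ => v ^ (s - 1) * (1 + v) ^ (-(s + t))) (Ioi 0) ∧
      ∫ v in Ioi (0 : ℝ), v ^ (s - 1) * (1 + v) ^ (-(s + t)) =
        Real.Gamma s * Real.Gamma t / Real.Gamma (s + t) := by
  have hst : 0 < s + t := by positivity
  have hG := Real.Gamma_pos_of_pos hst
  -- Integrating this kernel in v or in x first gives gamma integrals in either order; comparing
  -- them is the beta identity.
  set f : ℝ → ℝ → ℝ := fun x v =>
    x ^ (s + t - 1) * Real.exp (-(1 * x)) * (v ^ (s - 1) * Real.exp (-(x * v))) with hf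
  have hv : ∀ x : ℝ, 0 < x → ∫ v in Ioi (0 : ℝ), f x v =
      Real.Gamma s * (x ^ (t - 1) * Real.exp (-(1 * x))) := by
    intro x hx
    simp only [hf]
    rw [integral_const_mul, Real.integral_rpow_mul_exp_neg_mul_Ioi hs hx, one_div,
      Real.inv_rpow hx.le, ← Real.rpow_neg hx.le]
    have : x ^ (s + t - 1) * x ^ (-s) = x ^ (t - 1) := by
      rw [← Real.rpow_add hx]; congr 1; ring
    linear_combination (Real.exp (-(1 * x)) * Real.Gamma s) * this
  have hx : ∀ v : ℝ, 0 < v → ∫ x in Ioi (0 : ℝ), f x v =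
      Real.Gamma (s + t) * (v ^ (s - 1) * (1 + v) ^ (-(s + t))) := by
    intro v hv
    have h1v : 0 < 1 + v := by positivity
    have : ∀ x : ℝ, f x v = v ^ (s - 1) * (x ^ (s + t - 1) * Real.exp (-((1 + v) * x))) := by
      intro x
      simp only [hf]
      rw [show -((1 + v) * x) = -(1 * x) + -(x * v) by ring, Real.exp_add]
      ring
    simp only [this]
    rw [integral_const_mul, Real.integral_rpow_mul_exp_neg_mul_Ioi hst h1v, one_div,
      Real.inv_rpow h1v.le, ← Real.rpow_neg h1v.le]
    ring
  have hprod : Integrable (Function.uncurry f)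
      ((volume.restrict (Ioi 0)).prod (volume.restrict (Ioi 0))) := by
    rw [integrable_prod_iff]
    · constructor
      · filter_upwards [ae_restrict_mem measurableSet_Ioi] with x hx
        have := (integrableOn_rpow_mul_exp_neg_mul hs hx).const_mul
          (x ^ (s + t - 1) * Real.exp (-(1 * x)))
        exact this
      · refine ((integrableOn_rpow_mul_exp_neg_mul ht one_pos).const_mul (Real.Gamma s)).congr ?_
        filter_upwards [ae_restrict_mem measurableSet_Ioi] with x (hx' : 0 < x)
        rw [← hv x hx']
        refine setIntegral_congr_fun measurableSet_Ioi fun v (hv' : 0 < v) => ?_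
        refine (Real.norm_of_nonneg ?_).symm
        simp only [hf]
        positivity
    · refine Measurable.aestronglyMeasurable ?_
      simp only [hf, Function.uncurry_def]
      fun_prop
  constructor
  · have := (hprod.integral_prod_right).congr
      ((ae_restrict_mem measurableSet_Ioi).mono fun v hv' => hx v hv')
    have h2 := this.const_mul (Real.Gamma (s + t))⁻¹
    simpa [IntegrableOn, ← mul_assoc, inv_mul_cancel₀ hG.ne'] using h2
  · have := integral_integral_swap hprod
    rw [setIntegral_congr_fun measurableSet_Ioi hv, setIntegral_congr_fun measurableSet_Ioi hx,
      integral_const_mul, integral_const_mul,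
      Real.integral_rpow_mul_exp_neg_mul_Ioi ht one_pos] at this
    rw [eq_div_iff hG.ne', mul_comm, ← this]
    simp

theorem one_sub_one_add_rpow_neg_le {lam v : ℝ} (hlam : 0 ≤ lam) (hv : 0 ≤ v) :
    1 - (1 + v) ^ (-lam) ≤ lam * v := by
  have h1 : 0 < 1 + v := by linarith
  have h2 := Real.add_one_le_exp (Real.log (1 + v) * -lam)
  rw [← Real.rpow_def_of_pos h1] at h2
  have h3 := Real.log_le_sub_one_of_pos h1
  nlinarith

/-- Integrate by parts against x, then substitute v = x^(-δ) to reach a beta integral with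
parameters 1 - 1/δ and lam + 1/δ. The boundary terms vanish since the function is at most 1 near 0
and at most lam x^(-δ) at infinity, with δ > 1. -/
theorem integral_dagum {δ lam : ℝ} (hδ : 1 < δ) (hlam : 0 < lam)
    (hint : IntegrableOn (dagum lam δ) (Ioi 0)) :
    ∫ u in Ioi 0, dagum lam δ u =
      Real.Gamma (1 - 1 / δ) * Real.Gamma (1 / δ + lam) / Real.Gamma lam := by
  have hδ0 : 0 < δ := by linarith
  have hs : 0 < 1 - 1 / δ := by
    rw [sub_pos, div_lt_one hδ0]; exact hδ
  have ht : 0 < lam + 1 / δ := by positivity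
  obtain ⟨hbi, hbv⟩ := integrableOn_and_integral_rpow_mul_one_add_rpow hs ht
  rw [show 1 - 1 / δ + (lam + 1 / δ) = lam + 1 by ring] at hbi hbv
  have hφ : ∀ x : ℝ, 0 < x → dagum lam δ x = 1 - (1 + x ^ (-δ)) ^ (-lam) := by
    intro x hx
    rw [dagum_eq hx, ← Real.rpow_two, ← Real.rpow_mul hx.le]
    congr 4; ring
  set g : ℝ → ℝ := fun v => lam * (v ^ (1 - 1 / δ - 1) * (1 + v) ^ (-(lam + 1))) with hg
  have hgi : IntegrableOn g (Ioi 0) := hbi.const_mul lam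
  set φ' : ℝ → ℝ := fun x => -(lam * (1 + x ^ (-δ)) ^ (-(lam + 1)) * (δ * x ^ (-δ - 1))) with hφ'
  have hderiv : ∀ x ∈ Ioi (0 : ℝ), HasDerivAt (dagum lam δ) (φ' x) x := by
    intro x hx
    have hx : 0 < x := hx
    have h1 : HasDerivAt (fun x : ℝ => 1 - (1 + x ^ (-δ)) ^ (-lam)) (φ' x) x := by
      have h := (((Real.hasDerivAt_rpow_const (p := -δ) (Or.inl hx.ne')).const_add 1).rpow_const
        (p := -lam) (Or.inl (by positivity))).const_sub 1
      refine h.congr_deriv ?_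
      simp only [hφ']
      rw [neg_add']
      ring
    refine h1.congr_of_eventuallyEq ?_
    filter_upwards [lt_mem_nhds hx] with y hy
    exact hφ y hy
  have hsubst : ∀ x ∈ Ioi (0 : ℝ), (|-δ| * x ^ (-δ - 1)) • g (x ^ (-δ)) = -(φ' x * x) := by
    intro x hx
    have hx : 0 < x := hx
    simp only [hg, hφ', abs_neg, abs_of_pos hδ0, smul_eq_mul]
    have : (x ^ (-δ)) ^ (1 - 1 / δ - 1) = x := by
      rw [← Real.rpow_mul hx.le]
      have : -δ * (1 - 1 / δ - 1) = 1 := by field_simp; ring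
      rw [this, Real.rpow_one]
    rw [this]
    ring
  have hneg : IntegrableOn (fun x => -(φ' x * x)) (Ioi 0) :=
    ((integrableOn_Ioi_comp_rpow_iff g (p := -δ) (by linarith)).2 hgi).congr
      ((ae_restrict_mem measurableSet_Ioi).mono hsubst)
  have hnegv : ∫ x in Ioi (0 : ℝ), -(φ' x * x) =
      Real.Gamma (1 - 1 / δ) * Real.Gamma (1 / δ + lam) / Real.Gamma lam := by
    rw [← setIntegral_congr_fun measurableSet_Ioi hsubst,
      integral_comp_rpow_Ioi g (by linarith)]
    simp only [hg]
    rw [integral_const_mul, hbv, Real.Gamma_add_one hlam.ne', add_comm lam]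
    have := (Real.Gamma_pos_of_pos hlam).ne'
    field_simp
  have hx0 : Tendsto (fun x : ℝ => x) (𝓝[>] 0) (𝓝 0) := tendsto_id.mono_left nhdsWithin_le_nhds
  have hparts := integral_Ioi_mul_deriv_eq_deriv_mul (a := 0) (a' := 0) (b' := 0)
    (u := dagum lam δ) (v := fun x => x) (u' := φ') (v' := fun _ => 1) hderiv
    (fun x _ => hasDerivAt_id x) (by simpa [Pi.mul_def] using hint)
    (by simpa [Pi.mul_def, IntegrableOn] using hneg.neg)
    (by
      refine squeeze_zero' ?_ ?_ hx0
      · filter_upwards [self_mem_nhdsWithin] with x (hx : 0 < x)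
        exact mul_nonneg (dagum_mem_Icc hlam.le hx).1 hx.le
      · filter_upwards [self_mem_nhdsWithin] with x (hx : 0 < x)
        exact mul_le_of_le_one_left hx.le (dagum_mem_Icc hlam.le hx).2)
    (by
      have h0 : Tendsto (fun x : ℝ => lam * x ^ (-(δ - 1))) atTop (𝓝 0) := by
        simpa using (tendsto_rpow_neg_atTop (by linarith : 0 < δ - 1)).const_mul lam
      refine squeeze_zero' ?_ ?_ h0
      · filter_upwards [eventually_gt_atTop 0] with x hx
        exact mul_nonneg (dagum_mem_Icc hlam.le hx).1 hx.le
      · filter_upwards [eventually_gt_atTop 0] with x hx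
        have h1 := one_sub_one_add_rpow_neg_le hlam.le (Real.rpow_nonneg hx.le (-δ))
        rw [← hφ x hx] at h1
        calc dagum lam δ x * x ≤ lam * x ^ (-δ) * x := by gcongr
          _ = lam * x ^ (-(δ - 1)) := by
            rw [mul_assoc, ← Real.rpow_add_one hx.ne']
            congr 2; ring)
  simp only [mul_one, sub_self, zero_sub] at hparts
  rw [hparts, ← integral_neg, hnegv]

/-- Near 0 the product is of order at most τ^(β-1-a), integrable because a < β; beyond 1 the power
is at most 1 and the mixing density is itself integrable. -/
theorem integrableOn_rpow_mul_dagumMixing {β lam : ℝ} (hβ : β ∈ Ioo (0 : ℝ) 1) (hlam : 0 < lam)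
    (hβlam : β * lam ≤ 1) {a : ℝ} (ha : 0 ≤ a) (haβ : a < β) :
    IntegrableOn (fun τ => (4 * Real.pi * τ) ^ (-a) * dagumMixing β lam τ) (Ioi 0) := by
  have hpi := Real.pi_pos
  have hmeas : Measurable fun τ => (4 * Real.pi * τ) ^ (-a) * dagumMixing β lam τ :=
    Measurable.mul (by fun_prop) (measurable_dagumMixing _ _)
  have hmnn := dagumMixing_nonneg hβ hlam hβlam
  rw [← Ioc_union_Ioi_eq_Ioi zero_le_one]
  refine IntegrableOn.union ?_ ?_
  · obtain ⟨C, hC, hCle⟩ := exists_dagumMixing_le hβ hlam hβlam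
    have hi : IntegrableOn (fun τ : ℝ => (4 * Real.pi) ^ (-a) * C * τ ^ (β - 1 - a)) (Ioc 0 1) := by
      refine Integrable.const_mul ?_ _
      exact (intervalIntegrable_iff_integrableOn_Ioc_of_le zero_le_one).1
        (intervalIntegral.intervalIntegrable_rpow' (by linarith))
    refine hi.mono' hmeas.aestronglyMeasurable ?_
    filter_upwards [ae_restrict_mem measurableSet_Ioc] with τ hτ
    have hτ0 : 0 < τ := hτ.1
    have hm := hmnn τ
    rw [Real.norm_of_nonneg (by positivity), Real.mul_rpow (by positivity) hτ0.le]
    calc _ ≤ (4 * Real.pi) ^ (-a) * τ ^ (-a) * (C * τ ^ (β - 1)) := by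
          gcongr
          exact hCle τ hτ0
      _ = _ := by
          rw [sub_eq_add_neg (β - 1), Real.rpow_add hτ0]
          ring
  · refine ((integrableOn_dagumMixing hβ hlam hβlam).mono_set
      (Ioi_subset_Ioi zero_le_one)).mono' hmeas.aestronglyMeasurable ?_
    filter_upwards [ae_restrict_mem measurableSet_Ioi] with τ (hτ : 1 < τ)
    have hm := hmnn τ
    rw [Real.norm_of_nonneg (by positivity)]
    refine mul_le_of_le_one_left hm (Real.rpow_le_one_of_one_le_of_nonpos ?_ (by linarith))
    nlinarith [Real.pi_gt_three]

theorem tendsto_integral_heatKernel_mul_dagumMixing {β lam : ℝ} (hβ : β ∈ Ioo (0 : ℝ) 1)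
    (hlam : 0 < lam) (hβlam : β * lam ≤ 1) {a : ℝ} (ha : 0 ≤ a) (haβ : a < β) :
    Tendsto (fun z => ∫ τ in Ioi 0, heatKernel a z τ * dagumMixing β lam τ) (𝓝[>] 0)
      (𝓝 (∫ τ in Ioi 0, (4 * Real.pi * τ) ^ (-a) * dagumMixing β lam τ)) := by
  have hpi := Real.pi_pos
  refine tendsto_integral_filter_of_dominated_convergence
    (fun τ => (4 * Real.pi * τ) ^ (-a) * dagumMixing β lam τ) ?_ ?_
    (integrableOn_rpow_mul_dagumMixing hβ hlam hβlam ha haβ) ?_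
  · exact Eventually.of_forall fun z =>
      ((measurable_heatKernel a z).mul (measurable_dagumMixing β lam)).aestronglyMeasurable
  · refine Eventually.of_forall fun z => ?_
    filter_upwards [ae_restrict_mem measurableSet_Ioi] with τ (hτ : 0 < τ)
    have hm := dagumMixing_nonneg hβ hlam hβlam τ
    rw [Real.norm_of_nonneg (mul_nonneg (heatKernel_nonneg a z hτ) hm)]
    refine mul_le_mul_of_nonneg_right ?_ hm
    refine mul_le_of_le_one_right (by positivity) (Real.exp_le_one_iff.2 ?_)
    exact neg_nonpos.2 (by positivity)
  · filter_upwards [ae_restrict_mem measurableSet_Ioi] with τ (hτ : 0 < τ)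
    refine Tendsto.mul_const _ ?_
    have h : Tendsto (fun z => heatKernel a z τ) (𝓝 0) (𝓝 (heatKernel a 0 τ)) := by
      refine Continuous.tendsto ?_ 0
      unfold heatKernel
      fun_prop
    have h0 : heatKernel a 0 τ = (4 * Real.pi * τ) ^ (-a) := by
      simp [heatKernel]
    rw [h0] at h
    exact h.mono_left nhdsWithin_le_nhds

/-- Up to the factor π, (4πτ)^(-1/2) is the half-line integral of exp(-τu²). Exchanging the
integrals turns the left side into the integral of the Dagum function. -/
theorem integral_rpow_neg_half_mul_dagumMixing {δ lam : ℝ} (hδ : δ ∈ Ioo (1 : ℝ) 2)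
    (hlam : 0 < lam) (hδlam : δ * lam ≤ 2) :
    ∫ τ in Ioi 0, (4 * Real.pi * τ) ^ (-(1 / 2) : ℝ) * dagumMixing (δ / 2) lam τ =
      Real.pi⁻¹ * (Real.Gamma (1 - 1 / δ) * Real.Gamma (1 / δ + lam) / Real.Gamma lam) := by
  have hpi := Real.pi_pos
  have hβ : δ / 2 ∈ Ioo (0 : ℝ) 1 := ⟨by linarith [hδ.1], by linarith [hδ.2]⟩
  have hβlam : δ / 2 * lam ≤ 1 := by linarith
  set m := dagumMixing (δ / 2) lam with hm
  have hmnn : ∀ τ, 0 ≤ m τ := dagumMixing_nonneg hβ hlam hβlam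
  have hi := integrableOn_rpow_mul_dagumMixing hβ hlam hβlam (a := 1 / 2) (by norm_num)
    (by linarith [hδ.1])
  set f : ℝ → ℝ → ℝ := fun τ u => Real.exp (-τ * u ^ 2) * m τ with hf
  have hu : ∀ τ : ℝ, 0 < τ → ∫ u in Ioi (0 : ℝ), f τ u =
      Real.pi * ((4 * Real.pi * τ) ^ (-(1 / 2) : ℝ) * m τ) := by
    intro τ hτ
    simp only [hf]
    rw [integral_mul_const, integral_gaussian_Ioi, Real.rpow_neg (by positivity),
      ← Real.sqrt_eq_rpow, ← mul_assoc]
    congr 1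
    rw [show Real.pi / τ = (2 * Real.pi) ^ 2 / (4 * Real.pi * τ) by field_simp; ring,
      Real.sqrt_div (by positivity), Real.sqrt_sq (by positivity)]
    ring
  have hτ : ∀ u : ℝ, 0 < u → ∫ τ in Ioi (0 : ℝ), f τ u = dagum lam δ u := by
    intro u hu
    rw [dagum_eq hu,
      ← (integrableOn_and_integral_exp_mul_dagumMixing hβ hlam hβlam (sq_pos_of_pos hu)).2]
    simp only [hf, hm, neg_mul, mul_comm (u ^ 2)]
  have hprod : Integrable (Function.uncurry f)
      ((volume.restrict (Ioi 0)).prod (volume.restrict (Ioi 0))) := by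
    rw [integrable_prod_iff]
    · constructor
      · filter_upwards [ae_restrict_mem measurableSet_Ioi] with τ hτ'
        have := ((integrable_exp_neg_mul_sq hτ').integrableOn (s := Ioi 0)).mul_const (m τ)
        exact this
      · refine (hi.const_mul Real.pi).congr ?_
        filter_upwards [ae_restrict_mem measurableSet_Ioi] with τ (hτ' : 0 < τ)
        rw [← hu τ hτ']
        refine setIntegral_congr_fun measurableSet_Ioi fun u _ => ?_
        exact (Real.norm_of_nonneg (mul_nonneg (Real.exp_pos _).le (hmnn τ))).symm
    · refine Measurable.aestronglyMeasurable ?_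
      have h2 : Measurable fun p : ℝ × ℝ => m p.1 := (measurable_dagumMixing _ _).comp measurable_fst
      simp only [hf, Function.uncurry_def]
      exact Measurable.mul (by fun_prop) h2
  have hint : IntegrableOn (dagum lam δ) (Ioi 0) :=
    (hprod.integral_prod_right).congr
      ((ae_restrict_mem measurableSet_Ioi).mono fun u hu' => hτ u hu')
  have hswap := integral_integral_swap hprod
  rw [setIntegral_congr_fun measurableSet_Ioi hu, setIntegral_congr_fun measurableSet_Ioi hτ,
    integral_const_mul, integral_dagum hδ.1 hlam hint] at hswap
  rw [← hswap, ← mul_assoc, inv_mul_cancel₀ hpi.ne', one_mul]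

/-! ### Assembly of the theorem -/

theorem theorem4 (d : ℕ) (hd : 1 ≤ d) (δ lam : ℝ) (hδ : δ ∈ Set.Ioo (0 : ℝ) 2)
    (hlam : δ * lam ∈ Set.Ioc (0 : ℝ) 2) :
    -- the spectral density is well defined at every positive frequency
    (∀ z : ℝ, 0 < z → HasIsotropicSpectralDensityAt d (dagum lam δ) z
      (isotropicSpectralDensity d (dagum lam δ) z)) ∧
    (δ ∈ Set.Ioo (((d : ℝ) - 2) / 2) (d : ℝ) →
      Asymptotics.IsEquivalent (𝓝[>] (0 : ℝ))
        (fun z => isotropicSpectralDensity d (dagum lam δ) z)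
        (fun z => (2 : ℝ) ^ (-δ) * lam * Real.Gamma ((d : ℝ) / 2 - δ / 2) /
          (Real.pi ^ ((d : ℝ) / 2) * Real.Gamma (δ / 2)) * z ^ (δ - (d : ℝ)))) ∧
    (δ ∈ Set.Ioo (d : ℝ) 2 →
      Tendsto (fun z => isotropicSpectralDensity d (dagum lam δ) z) (𝓝[>] (0 : ℝ))
        (𝓝 (-(Real.Gamma (-(d : ℝ) / δ) * Real.Gamma ((d : ℝ) / δ + lam)) /
          (δ * Real.pi ^ ((d : ℝ) / 2) * (2 : ℝ) ^ ((d : ℝ) - 1) *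
            Real.Gamma ((d : ℝ) / 2) * Real.Gamma lam)))) := by
  have hpi := Real.pi_pos
  have hβ : δ / 2 ∈ Ioo (0 : ℝ) 1 := ⟨by linarith [hδ.1], by linarith [hδ.2]⟩
  have hl : 0 < lam := pos_of_mul_pos_right hlam.1 hδ.1.le
  have hβlam : δ / 2 * lam ≤ 1 := by linarith [hlam.2]
  have hlim := fun z (hz : 0 < z) => tendsto_regularizedHankel_dagum hd hδ hl hlam.2 hz
  have hS : ∀ z : ℝ, 0 < z → isotropicSpectralDensity d (dagum lam δ) z =
      ∫ τ in Ioi 0, heatKernel ((d : ℝ) / 2) z τ * dagumMixing (δ / 2) lam τ :=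
    fun z hz => (hlim z hz).limUnder_eq
  have hSev : (fun z => ∫ τ in Ioi 0, heatKernel ((d : ℝ) / 2) z τ * dagumMixing (δ / 2) lam τ)
      =ᶠ[𝓝[>] 0] fun z => isotropicSpectralDensity d (dagum lam δ) z := by
    filter_upwards [self_mem_nhdsWithin] with z hz
    exact (hS z hz).symm
  refine ⟨fun z hz => ⟨fun ε hε => integrableOn_exp_mul_hankelIntegrand hd hl hz hε, ?_⟩, ?_, ?_⟩
  · rw [hS z hz]
    exact hlim z hz
  · intro hδd
    have hβa : δ / 2 < (d : ℝ) / 2 := by linarith [hδd.2]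
    have hG1 := Real.Gamma_pos_of_pos (sub_pos.2 hβa)
    have hG2 := Real.Gamma_pos_of_pos hβ.1
    set K : ℝ := (2 : ℝ) ^ (-δ) * lam * Real.Gamma ((d : ℝ) / 2 - δ / 2) /
      (Real.pi ^ ((d : ℝ) / 2) * Real.Gamma (δ / 2)) with hK
    have hK0 : 0 < K := by positivity
    have hconst : lam / Real.Gamma (δ / 2) * (Real.pi ^ (-((d : ℝ) / 2)) * 4 ^ (-(δ / 2)) *
        Real.Gamma ((d : ℝ) / 2 - δ / 2)) = K := by
      rw [hK, Real.rpow_neg hpi.le, show (4 : ℝ) = 2 ^ (2 : ℝ) by norm_num,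
        ← Real.rpow_mul two_pos.le, show (2 : ℝ) * -(δ / 2) = -δ by ring]
      field_simp
    have h := tendsto_rpow_mul_integral_heatKernel_mul_dagumMixing hβ hβa hl hβlam
    rw [hconst] at h
    rw [Asymptotics.isEquivalent_iff_tendsto_one]
    · have h1 := h.div_const K
      rw [div_self hK0.ne'] at h1
      refine h1.congr' ?_
      filter_upwards [self_mem_nhdsWithin] with z (hz : 0 < z)
      simp only [Pi.div_apply]
      rw [hS z hz, ← Real.rpow_two, ← Real.rpow_mul hz.le,
        show (2 : ℝ) * ((d : ℝ) / 2 - δ / 2) = -(δ - d) by ring, Real.rpow_neg hz.le]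
      have := (Real.rpow_pos_of_pos hz (δ - d)).ne'
      field_simp
    · filter_upwards [self_mem_nhdsWithin] with z (hz : 0 < z)
      positivity
  · intro hδd
    -- The range d < δ < 2 leaves only dimension one.
    have hd1 : d = 1 := by
      have : (d : ℝ) < 2 := hδd.1.trans hδd.2
      have : d < 2 := by exact_mod_cast this
      omega
    subst hd1
    have hδ1 : 1 < δ := by simpa using hδd.1
    have hδ0 : 0 < δ := hδ.1
    have h := tendsto_integral_heatKernel_mul_dagumMixing hβ hl hβlam (a := 1 / 2) (by norm_num)
      (by linarith)
    rw [integral_rpow_neg_half_mul_dagumMixing ⟨hδ1, hδ.2⟩ hl hlam.2] at h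
    -- The functional equation brings the beta integral to the stated form; the remaining factor √π
    -- · Γ(1/2) in the denominator equals π.
    have hG : Real.Gamma (1 - 1 / δ) = -(1 / δ) * Real.Gamma (-1 / δ) := by
      have := Real.Gamma_add_one (s := -1 / δ) (div_ne_zero (by norm_num) hδ0.ne')
      rw [show 1 - 1 / δ = -1 / δ + 1 by ring, this]
      ring
    have hval : Real.pi⁻¹ * (Real.Gamma (1 - 1 / δ) * Real.Gamma (1 / δ + lam) / Real.Gamma lam) =
        -(Real.Gamma (-((1 : ℕ) : ℝ) / δ) * Real.Gamma (((1 : ℕ) : ℝ) / δ + lam)) /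
          (δ * Real.pi ^ (((1 : ℕ) : ℝ) / 2) * (2 : ℝ) ^ (((1 : ℕ) : ℝ) - 1) *
            Real.Gamma (((1 : ℕ) : ℝ) / 2) * Real.Gamma lam) := by
      simp only [Nat.cast_one, sub_self, Real.rpow_zero, mul_one]
      rw [hG, Real.Gamma_one_half_eq, ← Real.sqrt_eq_rpow]
      have hsq := Real.mul_self_sqrt hpi.le
      have hs := (Real.sqrt_pos.2 hpi).ne'
      have hGl := (Real.Gamma_pos_of_pos hl).ne'
      rw [mul_assoc δ, hsq]
      field_simp
    rw [← hval]
    refine h.congr' ?_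
    simpa using hSev
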